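/- **Theorem 2.2 (Extension Algorithm).** Let $q_0,q_1,q_2$ be the vertices of a (non-degenerate) triangle in $\mathbb{R}^2$, put $F_i(z)=\frac13 z+\frac23 q_i$ for $i=0,1,2$, $F_3(z)=\frac13 z+\frac13(q_1+q_2)$, $F_4(z)=\frac13 z+\frac13(q_0+q_2)$, $F_5(z)=\frac13 z+\frac13(q_0+q_1)$, and let $K=\mathcal{SG}_3$ be the unique nonempty compact set with $K=\bigcup_{i=0}^5F_iK$. For a finite word $w=w_1\cdots w_m$ in $\{0,\dots,5\}$ write $F_w=F_{w_1}\circ\cdots\circ F_{w_m}$; let $V_0=\{q_0,q_1,q_2\}$, $V_{m+1}=\bigcup_iF_iV_m$, and write $x\sim_m y$ if $x\ne y$ in $V_m$ are images of corners in a common $m$-cell $F_wK$, $|w|=m$ (that is, $x,y\in F_wV_0$). Let $$\mathcal{E}_m(u,v)=\left(\tfrac{7}{15}\right)^{-m}\sum_{x\sim_m y}(u(x)-u(y))(v(x)-v(y)),\qquad \mathcal{E}(u,v)=\lim_{m\to\infty}\mathcal{E}_m(u,v),$$ each edge being counted once, and let $\mathrm{dom}\,\mathcal{E}$ be the set of continuous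 $u$ on $K$ with $\sup_m\mathcal{E}_m(u,u)<\infty$. A continuous function $h$ on $K$ is called harmonic if, for every $m\ge 0$, it minimizes $\mathcal{E}_{m+1}(g,g)$ among all $g$ with $g=h$ on $V_m$. Let $h_a$ be the harmonic function with $h_a(q_0)=0$, $h_a(q_1)=1$, $h_a(q_2)=-1$, and let $$\Omega=\{x\in K\setminus V_0:h_a(x)>0\},\qquad X=\{x\in K:h_a(x)=0\},\qquad \partial\Omega=\{q_1\}\cup X.$$ For a continuous function $f$ on $\partial\Omega$, a solution of the Dirichlet problem $$\Delta u=0\ \text{ in }\Omega,\qquad u|_{\partial\Omega}=f \tag{1.1}$$ is a continuous function $u$ on $\bar\Omega$ with $u=f$ on $\partial\Omega$ such that $u\circ F_w\in\mathrm{dom}\,\mathcal{E}$ for every cell $F_wK\subset\Omega$, and $\mathcal{E}(u,v)=0$ for every $v\in\mathrm{dom}\,\mathcal{E}$ with compact support in $\Omega$. Let $$x_\emptyset=F_1q_2,\quad y_\emptyset=F_1q_0,\quad z_\emptyset=F_0q_1,\quad p_\emptyset=F_3q_0,$$ let $\tilde W_*$ be the set of all finite words in $\{0,3\}$, including the empty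 one, and let $\mu=\sum_{w\in\tilde W_*}\frac27\mu_w\delta_{F_wp_\emptyset}$, where $\mu_w=\mu_{w_1}\cdots\mu_{w_{|w|}}$, $\mu_0=\frac17$, $\mu_3=\frac47$. For every continuous $f$ on $\partial\Omega$ the problem (1.1) has a unique solution $u$, and $$\begin{aligned} u(x_\emptyset)&=\tfrac{4}{15}f(q_1)+\tfrac1{15}f(p_\emptyset)+\tfrac1{30}\int_Xf\circ F_0\,d\mu+\tfrac{19}{30}\int_Xf\circ F_3\,d\mu,\\ u(y_\emptyset)&=\tfrac13f(q_1)+\tfrac13f(p_\emptyset)+\tfrac16\int_Xf\circ F_0\,d\mu+\tfrac16\int_Xf\circ F_3\,d\mu,\\ u(z_\emptyset)&=\tfrac1{15}f(q_1)+\tfrac4{15}f(p_\emptyset)+\tfrac{19}{30}\int_Xf\circ F_0\,d\mu+\tfrac1{30}\int_Xf\circ F_3\,d\mu. \end{aligned}$$ Moreover, $u$ is determined everywhere by self-similarity: for every $w\in\tilde W_*$, the function $u\circ F_w$ is the solution of the Dirichlet problem with the boundary values $u(F_wq_1)$ at $q_1$ and $f\circ F_w$ on $X$, so that the three formulas hold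 with $u\circ F_w$, $u(F_wq_1)$ and $f\circ F_w$ in place of $u$, $f(q_1)$ and $f$; the functions $u\circ F_w\circ F_1$ and $u\circ F_w\circ F_5$ are harmonic on $K$; a harmonic function on $K$ is determined by its values at $q_0,q_1,q_2$; and $\bar\Omega$ is the closure of $\bigcup_{w\in\tilde W_*}F_w(F_1K\cup F_5K)$. -/

import Mathlib

open Set Filter Topology MeasureTheory

noncomputable section

namespace SG3

/-- The Euclidean plane. -/
abbrev Plane : Type := EuclideanSpace ℝ (Fin 2)

/-! ### The level-3 Sierpinski gasket with corners `q 0`, `q 1`, `q 2` -/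

/-- The translation parts of the six similarities of ratio `1/3`. -/
def shift (q : Fin 3 → Plane) : Fin 6 → Plane :=
  ![(2 / 3 : ℝ) • q 0, (2 / 3 : ℝ) • q 1, (2 / 3 : ℝ) • q 2,
    (1 / 3 : ℝ) • (q 1 + q 2), (1 / 3 : ℝ) • (q 0 + q 2), (1 / 3 : ℝ) • (q 0 + q 1)]

/-- The six similarities `F_i(z) = z/3 + d_i`. For `i = 0, 1, 2` the map `F_i` fixes `q i`. -/
def F (q : Fin 3 → Plane) (i : Fin 6) (z : Plane) : Plane := (1 / 3 : ℝ) • z + shift q i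

/-- `F_w = F_{w_1} ∘ ⋯ ∘ F_{w_m}` for a word `w = w_1 ⋯ w_m`. -/
def Fw (q : Fin 3 → Plane) : List (Fin 6) → Plane → Plane
  | [] => id
  | i :: w => F q i ∘ Fw q w

/-- The vertex sets `V_m`. -/
def V (q : Fin 3 → Plane) : ℕ → Set Plane
  | 0 => range q
  | m + 1 => ⋃ i : Fin 6, F q i '' V q m

/-- The level-3 Sierpinski gasket, as the closure of `V_* = ⋃ V_m`. It is the unique nonempty
compact set `K` with `K = ⋃ F_i K`: see `gasket_spec` and `gasket_unique`. -/
def gasket (q : Fin 3 → Plane) : Set Plane := closure (⋃ m, V q m)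

lemma F_corner (q : Fin 3 → Plane) (i : Fin 3) : ∃ j : Fin 6, F q j (q i) = q i := by
  fin_cases i
  · refine ⟨0, ?_⟩
    simp only [F, shift]
    simp
    module
  · refine ⟨1, ?_⟩
    simp only [F, shift]
    simp
    module
  · refine ⟨2, ?_⟩
    simp only [F, shift]
    simp
    module

lemma V_subset_hull (q : Fin 3 → Plane) (m : ℕ) : V q m ⊆ convexHull ℝ (range q) := by
  induction m with
  | zero => exact subset_convexHull ℝ _
  | succ m ih =>
    have hc := convex_convexHull ℝ (range q)
    have hq : ∀ i, q i ∈ convexHull ℝ (range q) := fun i => subset_convexHull ℝ _ (mem_range_self i)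
    have key : ∀ a ∈ convexHull ℝ (range q), ∀ b ∈ convexHull ℝ (range q),
        ∀ c ∈ convexHull ℝ (range q),
        (1 / 3 : ℝ) • a + (1 / 3 : ℝ) • (b + c) ∈ convexHull ℝ (range q) := by
      intro a ha b hb c hc'
      have h1 : (1 / 2 : ℝ) • b + (1 / 2 : ℝ) • c ∈ convexHull ℝ (range q) :=
        hc hb hc' (by norm_num) (by norm_num) (by norm_num)
      have h2 := hc ha h1 (a := (1 / 3 : ℝ)) (b := 2 / 3) (by norm_num) (by norm_num) (by norm_num)
      convert h2 using 1
      module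
    intro x hx
    simp only [V, mem_iUnion] at hx
    obtain ⟨i, y, hy, rfl⟩ := hx
    have hy' := ih hy
    have e : ∀ a : Plane, (2 / 3 : ℝ) • a = (1 / 3 : ℝ) • (a + a) := by
      intro a
      module
    fin_cases i <;> simp only [F, shift] <;> simp [-one_div, -smul_add] <;> try rw [e]
    all_goals exact key _ hy' _ (hq _) _ (hq _)

lemma F_dist (q : Fin 3 → Plane) (i : Fin 6) (x y : Plane) :
    dist (F q i x) (F q i y) = (1 / 3) * dist x y := by
  simp only [F, dist_add_right, dist_smul₀]
  norm_num

lemma F_continuous (q : Fin 3 → Plane) (i : Fin 6) : Continuous (F q i) := by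
  unfold F
  fun_prop

/-- The gasket is a nonempty compact set that is the union of its images under the six maps. -/
theorem gasket_spec (q : Fin 3 → Plane) :
    (gasket q).Nonempty ∧ IsCompact (gasket q) ∧ gasket q = ⋃ i, F q i '' gasket q := by
  have hcomp : IsCompact (gasket q) := by
    have hT : IsCompact (convexHull ℝ (range q)) := (finite_range q).isCompact_convexHull ℝ
    exact hT.of_isClosed_subset isClosed_closure
      (closure_minimal (iUnion_subset (V_subset_hull q)) hT.isClosed)
  have hV : (⋃ m, V q m) = ⋃ i, F q i '' (⋃ m, V q m) := by
    apply Subset.antisymm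
    · intro x hx
      obtain ⟨m, hm⟩ := mem_iUnion.1 hx
      cases m with
      | zero =>
        obtain ⟨i, rfl⟩ := hm
        obtain ⟨j, hj⟩ := F_corner q i
        exact mem_iUnion.2 ⟨j, q i, mem_iUnion.2 ⟨0, mem_range_self i⟩, hj⟩
      | succ m =>
        obtain ⟨i, y, hy, rfl⟩ := mem_iUnion.1 hm
        exact mem_iUnion.2 ⟨i, y, mem_iUnion.2 ⟨m, hy⟩, rfl⟩
    · intro x hx
      obtain ⟨i, y, hy, rfl⟩ := mem_iUnion.1 hx
      obtain ⟨m, hm⟩ := mem_iUnion.1 hy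
      exact mem_iUnion.2 ⟨m + 1, mem_iUnion.2 ⟨i, y, hm, rfl⟩⟩
  refine ⟨⟨q 0, subset_closure (mem_iUnion.2 ⟨0, mem_range_self 0⟩)⟩, hcomp, ?_⟩
  have him : ∀ i, F q i '' gasket q = closure (F q i '' (⋃ m, V q m)) := fun i =>
    image_closure_of_isCompact hcomp (F_continuous q i).continuousOn
  rw [iUnion_congr him, ← closure_iUnion_of_finite, ← hV]
  rfl

/-- The gasket is the only such set. -/
theorem gasket_unique (q : Fin 3 → Plane) (A : Set Plane) (hne : A.Nonempty) (hA : IsCompact A)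
    (hfix : A = ⋃ i, F q i '' A) : A = gasket q := by
  have main : ∀ A B : Set Plane, A.Nonempty → IsCompact A → A = ⋃ i, F q i '' A →
      B.Nonempty → IsCompact B → B = ⋃ i, F q i '' B → A ⊆ B := by
    intro A B hAne hAc hAf hBne hBc hBf
    obtain ⟨a, ha, hmax⟩ := hAc.exists_isMaxOn hAne
      (Metric.continuous_infDist_pt B).continuousOn
    have h0 : Metric.infDist a B ≤ 0 := by
      have ha' := ha
      rw [hAf] at ha'
      obtain ⟨i, y, hy, rfl⟩ := mem_iUnion.1 ha'
      obtain ⟨b, hb, hyb⟩ := hBc.exists_infDist_eq_dist hBne y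
      have hFb : F q i b ∈ B := by
        rw [hBf]
        exact mem_iUnion.2 ⟨i, b, hb, rfl⟩
      have h1 : Metric.infDist (F q i y) B ≤ (1 / 3) * Metric.infDist y B := by
        rw [hyb, ← F_dist q i y b]
        exact Metric.infDist_le_dist_of_mem hFb
      have h2 : Metric.infDist y B ≤ Metric.infDist (F q i y) B := hmax hy
      linarith
    intro x hx
    rw [hBc.isClosed.mem_iff_infDist_zero hBne]
    exact le_antisymm ((hmax hx).trans h0) Metric.infDist_nonneg
  obtain ⟨h1, h2, h3⟩ := gasket_spec q
  exact Subset.antisymm (main _ _ hne hA hfix h1 h2 h3) (main _ _ h1 h2 h3 hne hA hfix)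

/-! ### Energy and harmonic functions

Functions on subsets of the gasket are written as functions on the plane; only their values on the
relevant subset matter. -/

/-- The graph energy `E_m(u, v) = (7/15)^{-m} ∑_{x ∼_m y} (u x - u y) (v x - v y)`. Every edge of
the `m`-th graph lies in exactly one `m`-cell `F_w K`, and the three edges of that cell join
`F_w q_i` to `F_w q_{i+1}` (indices mod 3), so each edge is counted once. -/
def energy (q : Fin 3 → Plane) (m : ℕ) (u v : Plane → ℝ) : ℝ :=
  ((7 / 15 : ℝ) ^ m)⁻¹ * ∑ w : Fin m → Fin 6, ∑ i : Fin 3,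
    (u (Fw q (List.ofFn w) (q i)) - u (Fw q (List.ofFn w) (q (i + 1)))) *
      (v (Fw q (List.ofFn w) (q i)) - v (Fw q (List.ofFn w) (q (i + 1))))

/-- `u ∈ dom E`: continuous on the gasket, with bounded graph energies. -/
def MemDom (q : Fin 3 → Plane) (u : Plane → ℝ) : Prop :=
  ContinuousOn u (gasket q) ∧ BddAbove (range fun m => energy q m u u)

/-- Harmonic functions on the whole gasket (with the three corners as boundary): continuous, and
minimizing the energy from each level to the next one. -/
def IsHarmonic (q : Fin 3 → Plane) (h : Plane → ℝ) : Prop :=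
  ContinuousOn h (gasket q) ∧
    ∀ (m : ℕ) (g : Plane → ℝ), EqOn g h (V q m) → energy q (m + 1) h h ≤ energy q (m + 1) g g

/-- `Δ u = 0` in a relatively open subset `U` of the gasket, in the weak formulation: `u` is locally
in `dom E` (it is so on every cell contained in `U`), and `E(u, v) = lim E_m(u, v) = 0` for all
`v ∈ dom E` whose support is a compact subset of `U`. For large `m` only values of `u` in `U` enter
`E_m(u, v)`. -/
def HarmonicIn (q : Fin 3 → Plane) (U : Set Plane) (u : Plane → ℝ) : Prop :=
  (∀ w : List (Fin 6), Fw q w '' gasket q ⊆ U → MemDom q (u ∘ Fw q w)) ∧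
    ∀ v : Plane → ℝ, MemDom q v → closure {x ∈ gasket q | v x ≠ 0} ⊆ U →
      Tendsto (fun m => energy q m u v) atTop (𝓝 0)

/-! ### The half domain -/

/-- The antisymmetric harmonic function `h_a` with values `(0, 1, -1)` at `(q 0, q 1, q 2)`. There is
exactly one such function on the gasket; off the gasket its values are irrelevant. -/
def ha (q : Fin 3 → Plane) : Plane → ℝ :=
  Classical.epsilon fun h => IsHarmonic q h ∧ h (q 0) = 0 ∧ h (q 1) = 1 ∧ h (q 2) = -1

/-- The half domain `Ω = {x ∈ K \ V_0 : h_a(x) > 0}`. -/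
def Ω (q : Fin 3 → Plane) : Set Plane := {x ∈ gasket q \ V q 0 | 0 < ha q x}

/-- The Cantor set part `X = {x ∈ K : h_a(x) = 0}` of the boundary. -/
def X (q : Fin 3 → Plane) : Set Plane := {x ∈ gasket q | ha q x = 0}

/-- The boundary `∂Ω = {q_1} ∪ X`. -/
def bdry (q : Fin 3 → Plane) : Set Plane := {q 1} ∪ X q

/-- `u`, continuous on the closure of `Ω`, solves `Δ u = 0` in `Ω`, `u = f` on `∂Ω`. -/
structure IsDirichletSolution (q : Fin 3 → Plane) (f u : Plane → ℝ) : Prop where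
  continuousOn : ContinuousOn u (closure (Ω q))
  harmonicIn : HarmonicIn q (Ω q) u
  boundary : EqOn u f (bdry q)

/-- The crucial vertex `x_∅ = F_1 q_2`. -/
def xv (q : Fin 3 → Plane) : Plane := F q 1 (q 2)

/-- The crucial vertex `y_∅ = F_1 q_0`. -/
def yv (q : Fin 3 → Plane) : Plane := F q 1 (q 0)

/-- The crucial vertex `z_∅ = F_0 q_1`. -/
def zv (q : Fin 3 → Plane) : Plane := F q 0 (q 1)

/-- The point `p_∅ = F_3 q_0` of `X`. -/
def pv (q : Fin 3 → Plane) : Plane := F q 3 (q 0)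

/-- The finite words in the two letters `0` and `3`. -/
abbrev HalfWord : Type := {w : List (Fin 6) // ∀ i ∈ w, i = 0 ∨ i = 3}

/-- `μ_w = μ_{w_1} ⋯ μ_{w_m}` with `μ_0 = 1/7` and `μ_3 = 4/7`. -/
def weight (w : HalfWord) : ℝ := (w.1.map fun i => if i = 0 then (1 / 7 : ℝ) else 4 / 7).prod

/-- The measure `μ = ∑_w (2/7) μ_w δ_{p_w}`, `p_w = F_w p_∅`, over all words `w` in `0` and `3`. -/
def μ (q : Fin 3 → Plane) : Measure Plane :=
  Measure.sum fun w : HalfWord =>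
    ENNReal.ofReal (2 / 7 * weight w) • Measure.dirac (Fw q w.1 (pv q))

end SG3

end

noncomputable section

namespace SG3

variable {q : Fin 3 → Plane}

/-! Put `c = f (q 1)`. A solution is harmonic on the cells 1 and 5 and solves the same kind of
problem on the copies of `Ω` in the cells 0 and 3; these pieces meet at `x = x_∅`, `y = y_∅`, `z =
z_∅`. Everything rests on one guess: the flux of the solution at `q 1` is `3 (c - ∫ f dμ)`. Balance
of fluxes at the three vertices then reads `5x = y + c + 3 ∫ f∘F_3`, `4y = c + f(p_∅) + x + z`, `5z
= y + f(p_∅) + 3 ∫ f∘F_0`, whose solution is the three formulas. The guess reproduces itself: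
`(15/7)(2c - x - y) = 3 (c - ∫ f dμ)` is the self-similarity of `μ` (`integralX_split`). This is the
induction of `energy_sol`.

Existence: the formulas define approximations `solApprox` recursively. They are monotone in the data
(`solApprox_le`) and exact for data constant on `X` (`solApprox_const`), hence uniformly Cauchy
(`solApprox_cauchy`). By `energy_sol` the limit `sol` has zero energy against test functions
vanishing at `q 1`.

Uniqueness: `HarmonicIn` is reduced to the discrete condition `IsWeak` by testing with piecewise
harmonic splines, and a truncation argument gives the maximum principle `IsWeak.eq_zero`. It also
shows that a solution is harmonic on the cells 1 and 5 up to their corners. Behind both halves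
stands `energy_harm`: pairing with a harmonic function gives the same energy on every level. -/

/-! ### Barycentric coordinates and the ten vertices of the first level -/

/-- The corners of the triangle as an affine basis of the plane. -/
def cornerBasis (hq : AffineIndependent ℝ q) : AffineBasis (Fin 3) ℝ Plane :=
  ⟨q, hq, by
    rw [hq.affineSpan_eq_top_iff_card_eq_finrank_add_one]
    simp⟩

/-- The barycentric coordinates with respect to the corners. -/
def bary (hq : AffineIndependent ℝ q) (k : Fin 3) : Plane →ᵃ[ℝ] ℝ := (cornerBasis hq).coord k

lemma bary_corner (hq : AffineIndependent ℝ q) (k j : Fin 3) :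
    bary hq k (q j) = if k = j then 1 else 0 :=
  (cornerBasis hq).coord_apply k j

lemma sum_bary (hq : AffineIndependent ℝ q) (x : Plane) : ∑ k, bary hq k x = 1 :=
  (cornerBasis hq).sum_coord_apply_eq_one x

lemma bary_ext (hq : AffineIndependent ℝ q) {x y : Plane} (h : ∀ k, bary hq k x = bary hq k y) :
    x = y :=
  (cornerBasis hq).ext_elem h

lemma bary_continuous (hq : AffineIndependent ℝ q) (k : Fin 3) : Continuous (bary hq k) :=
  (bary hq k).continuous_of_finiteDimensional

/-- Three times the barycentric coordinates of the translation part of `F_i`. -/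
def offset : Fin 6 → Fin 3 → ℕ :=
  ![![2, 0, 0], ![0, 2, 0], ![0, 0, 2], ![0, 1, 1], ![1, 0, 1], ![1, 1, 0]]

lemma map_third_add (φ : Plane →ᵃ[ℝ] ℝ) (x y z : Plane) :
    φ ((1 / 3 : ℝ) • x + (1 / 3 : ℝ) • (y + z)) = (φ x + φ y + φ z) / 3 := by
  have h := fun v => congrFun φ.decomp v
  simp only [Pi.add_apply] at h
  rw [h, h x, h y, h z]
  simp only [map_add, map_smul, smul_eq_mul]
  ring

lemma bary_F (hq : AffineIndependent ℝ q) (k : Fin 3) (i : Fin 6) (x : Plane) :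
    3 * bary hq k (F q i x) = offset i k + bary hq k x := by
  have e : ∀ a : Plane, (2 / 3 : ℝ) • a = (1 / 3 : ℝ) • (a + a) := by
    intro a
    module
  fin_cases i <;> simp [F, shift, -one_div, -smul_add] <;> try rw [e]
  all_goals
    rw [map_third_add]
    simp only [bary_corner]
    fin_cases k <;> simp [offset] <;> ring

lemma gasket_closed (q : Fin 3 → Plane) : IsClosed (gasket q) := isClosed_closure

lemma gasket_compact (q : Fin 3 → Plane) : IsCompact (gasket q) := (gasket_spec q).2.1

lemma F_mem (i : Fin 6) {x : Plane} (hx : x ∈ gasket q) : F q i x ∈ gasket q := by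
  rw [(gasket_spec q).2.2]
  exact mem_iUnion.2 ⟨i, x, hx, rfl⟩

lemma exists_F_eq {x : Plane} (hx : x ∈ gasket q) : ∃ i, ∃ y ∈ gasket q, F q i y = x := by
  rw [(gasket_spec q).2.2] at hx
  exact mem_iUnion.1 hx

lemma V_subset (m : ℕ) : V q m ⊆ gasket q :=
  (subset_iUnion (V q) m).trans subset_closure

lemma corner_mem (k : Fin 3) : q k ∈ gasket q := V_subset 0 (mem_range_self k)

lemma bary_nonneg (hq : AffineIndependent ℝ q) (k : Fin 3) {x : Plane} (hx : x ∈ gasket q) :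
    0 ≤ bary hq k x := by
  have h1 : IsClosed {x | 0 ≤ bary hq k x} :=
    isClosed_le continuous_const (bary_continuous hq k)
  refine closure_minimal (iUnion_subset fun m => ?_) h1 hx
  refine (V_subset_hull q m).trans fun y hy => ?_
  have := (cornerBasis hq).convexHull_eq_nonneg_coord
  change convexHull ℝ (range q) = _ at this
  rw [this] at hy
  exact hy k

lemma eq_corner_of_one_le (hq : AffineIndependent ℝ q) {k : Fin 3} {x : Plane}
    (hx : x ∈ gasket q) (h : 1 ≤ bary hq k x) : x = q k := by
  have h0 := bary_nonneg hq 0 hx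
  have h1 := bary_nonneg hq 1 hx
  have h2 := bary_nonneg hq 2 hx
  have hs := sum_bary hq x
  simp only [Fin.sum_univ_three] at hs
  refine bary_ext hq fun j => ?_
  rw [bary_corner]
  fin_cases k <;> fin_cases j <;> simp at h ⊢ <;> linarith

/-- All rows of `offset` have sum 2, so of two different rows each exceeds the other somewhere. -/
lemma exists_offset_lt {i j : Fin 6} (h : i ≠ j) : ∃ k, offset j k + 1 ≤ offset i k := by
  revert i j
  decide

/-- Different cells of the first level meet only in corners. -/
lemma corner_of_F_eq (hq : AffineIndependent ℝ q) {i j : Fin 6} (hij : i ≠ j) {x y : Plane}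
    (hx : x ∈ gasket q) (hy : y ∈ gasket q) (h : F q i x = F q j y) : ∃ b, y = q b := by
  -- Along this coordinate the offsets differ by at least one, which pushes the `k`-th coordinate of
  -- `y` up to one.
  obtain ⟨k, hk⟩ := exists_offset_lt hij
  have h1 := bary_F hq k i x
  have h2 := bary_F hq k j y
  rw [h] at h1
  have h3 := bary_nonneg hq k hx
  have h4 : (offset j k : ℝ) + 1 ≤ offset i k := by exact_mod_cast hk
  exact ⟨k, eq_corner_of_one_le hq hy (by linarith)⟩

lemma F_injective (q : Fin 3 → Plane) (i : Fin 6) : Function.Injective (F q i) := by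
  intro x y h
  have h1 := F_dist q i x y
  rw [h, dist_self] at h1
  exact dist_le_zero.1 (by linarith)

/-- The index of the vertex `F_i (q a)` among the ten vertices of the first level: the corners,
the centre, and the six points on the sides. -/
def vertexIndex : Fin 6 → Fin 3 → Fin 10 :=
  ![![0, 4, 9], ![5, 1, 6], ![8, 7, 2], ![3, 6, 7], ![9, 3, 8], ![4, 5, 3]]

/-- A cell and a corner for each of the ten vertices. -/
def vertexAddress : Fin 10 → Fin 6 × Fin 3 :=
  ![(0, 0), (1, 1), (2, 2), (3, 0), (0, 1), (1, 0), (1, 2), (2, 1), (2, 0), (0, 2)]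

/-- The ten vertices of the first level. -/
def vertex (q : Fin 3 → Plane) (n : Fin 10) : Plane := F q (vertexAddress n).1 (q (vertexAddress n).2)

lemma F_eq_vertex (q : Fin 3 → Plane) (i : Fin 6) (a : Fin 3) :
    F q i (q a) = vertex q (vertexIndex i a) := by
  fin_cases i <;> fin_cases a <;> simp [vertex, vertexIndex, vertexAddress, F, shift] <;> module

/-- Three times the barycentric coordinates are integers that separate the ten vertices, so this is
a finite check. -/
lemma vertexIndex_eq_of_offset {i j : Fin 6} {a b : Fin 3}
    (h : ∀ k, offset i k + (if k = a then 1 else 0) = offset j k + (if k = b then 1 else 0)) :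
    vertexIndex i a = vertexIndex j b := by
  revert i j a b
  decide

lemma vertexIndex_eq (hq : AffineIndependent ℝ q) {i j : Fin 6} {a b : Fin 3}
    (h : F q i (q a) = F q j (q b)) : vertexIndex i a = vertexIndex j b := by
  refine vertexIndex_eq_of_offset fun k => ?_
  have h1 := bary_F hq k i (q a)
  rw [h, bary_F, bary_corner, bary_corner] at h1
  exact_mod_cast h1.symm

lemma F_corner_self (q : Fin 3 → Plane) :
    F q 0 (q 0) = q 0 ∧ F q 1 (q 1) = q 1 ∧ F q 2 (q 2) = q 2 := by
  refine ⟨?_, ?_, ?_⟩ <;> simp [F, shift] <;> module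

/-! ### Gluing functions along the cells of the first level -/

open Classical in
/-- The function that is `g i ∘ F_i⁻¹` on the cell `F_i K`. -/
def glue (q : Fin 3 → Plane) (g : Fin 6 → Plane → ℝ) (x : Plane) : ℝ :=
  if h : ∃ p : Fin 6 × Plane, p.2 ∈ gasket q ∧ F q p.1 p.2 = x then g h.choose.1 h.choose.2 else 0

/-- The cell chosen in `glue` is immaterial: two cells share only corners, and there `val`
prescribes one value per vertex. -/
lemma glue_F (hq : AffineIndependent ℝ q) {g : Fin 6 → Plane → ℝ} (val : Fin 10 → ℝ)
    (hg : ∀ i a, g i (q a) = val (vertexIndex i a)) (i : Fin 6) {x : Plane} (hx : x ∈ gasket q) :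
    glue q g (F q i x) = g i x := by
  have h : ∃ p : Fin 6 × Plane, p.2 ∈ gasket q ∧ F q p.1 p.2 = F q i x := ⟨(i, x), hx, rfl⟩
  rw [glue, dif_pos h]
  obtain ⟨h1, h2⟩ := h.choose_spec
  set p := h.choose
  by_cases hi : p.1 = i
  · rw [hi] at h2 ⊢
    rw [F_injective q i h2]
  · obtain ⟨b, hb⟩ := corner_of_F_eq hq hi h1 hx h2
    obtain ⟨a, ha⟩ := corner_of_F_eq hq (Ne.symm hi) hx h1 h2.symm
    rw [ha, hb] at h2 ⊢
    rw [hg, hg, vertexIndex_eq hq h2]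

lemma continuousOn_of_cells {u : Plane → ℝ} (h : ∀ i, ContinuousOn (u ∘ F q i) (gasket q)) :
    ContinuousOn u (gasket q) := by
  rw [(gasket_spec q).2.2]
  refine (locallyFinite_of_finite _).continuousOn_iUnion
    (fun i => ((gasket_compact q).image (F_continuous q i)).isClosed) fun i => ?_
  -- The inverse of `F q i`, which carries continuity over to the cell.
  have hG : Continuous fun z : Plane => (3 : ℝ) • (z - shift q i) := by fun_prop
  have hGF : ∀ x, (3 : ℝ) • (F q i x - shift q i) = x := fun x => by simp [F, smul_smul]
  refine ((h i).comp hG.continuousOn (s := F q i '' gasket q) ?_).congr ?_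
  · rintro _ ⟨x, hx, rfl⟩
    simpa only [hGF] using hx
  · rintro _ ⟨x, hx, rfl⟩
    simp only [Function.comp_apply, hGF]

lemma glue_continuousOn (hq : AffineIndependent ℝ q) {g : Fin 6 → Plane → ℝ} (val : Fin 10 → ℝ)
    (hg : ∀ i a, g i (q a) = val (vertexIndex i a)) (hc : ∀ i, ContinuousOn (g i) (gasket q)) :
    ContinuousOn (glue q g) (gasket q) :=
  continuousOn_of_cells fun i => (hc i).congr fun _ hx => glue_F hq val hg i hx

lemma glue_corner (hq : AffineIndependent ℝ q) {g : Fin 6 → Plane → ℝ} (val : Fin 10 → ℝ)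
    (hg : ∀ i a, g i (q a) = val (vertexIndex i a)) :
    glue q g (q 0) = val 0 ∧ glue q g (q 1) = val 1 ∧ glue q g (q 2) = val 2 := by
  obtain ⟨h0, h1, h2⟩ := F_corner_self q
  refine ⟨?_, ?_, ?_⟩
  · conv_lhs => rw [← h0, glue_F hq val hg 0 (corner_mem 0), hg]
    rfl
  · conv_lhs => rw [← h1, glue_F hq val hg 1 (corner_mem 1), hg]
    rfl
  · conv_lhs => rw [← h2, glue_F hq val hg 2 (corner_mem 2), hg]
    rfl

/-! ### Uniform limits -/

/-- The pointwise limit of a sequence of functions. -/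
def limFun (g : ℕ → Plane → ℝ) (x : Plane) : ℝ := limUnder atTop fun n => g n x

lemma limFun_tendsto {s : Set Plane} {g : ℕ → Plane → ℝ}
    (h : ∀ ε > 0, ∃ n, ∀ k, ∀ x ∈ s, |g (n + k) x - g n x| ≤ ε) {x : Plane} (hx : x ∈ s) :
    Tendsto (fun n => g n x) atTop (𝓝 (limFun g x)) := by
  refine CauchySeq.tendsto_limUnder (Metric.cauchySeq_iff'.2 fun ε hε => ?_)
  obtain ⟨n, hn⟩ := h (ε / 2) (half_pos hε)
  refine ⟨n, fun m hm => ?_⟩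
  obtain ⟨k, rfl⟩ := Nat.exists_eq_add_of_le hm
  exact (hn k x hx).trans_lt (half_lt_self hε)

lemma abs_limFun_sub_le {s : Set Plane} {g : ℕ → Plane → ℝ}
    (h : ∀ ε > 0, ∃ n, ∀ k, ∀ x ∈ s, |g (n + k) x - g n x| ≤ ε) {ε : ℝ} {n : ℕ}
    (hn : ∀ k, ∀ x ∈ s, |g (n + k) x - g n x| ≤ ε) {x : Plane} (hx : x ∈ s) :
    |limFun g x - g n x| ≤ ε := by
  have h1 := (limFun_tendsto h hx).comp (tendsto_add_atTop_nat n)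
  refine le_of_tendsto ((h1.sub_const (g n x)).abs) (Eventually.of_forall fun k => ?_)
  have := hn k x hx
  rwa [add_comm] at this

lemma limFun_continuousOn {s : Set Plane} {g : ℕ → Plane → ℝ}
    (h : ∀ ε > 0, ∃ n, ∀ k, ∀ x ∈ s, |g (n + k) x - g n x| ≤ ε)
    (hc : ∀ n, ContinuousOn (g n) s) : ContinuousOn (limFun g) s := by
  have hu : TendstoUniformlyOn g (limFun g) atTop s := by
    rw [Metric.tendstoUniformlyOn_iff]
    intro ε hε
    obtain ⟨n, hn⟩ := h (ε / 3) (by positivity)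
    refine eventually_atTop.2 ⟨n, fun m hm x hx => ?_⟩
    obtain ⟨k, rfl⟩ := Nat.exists_eq_add_of_le hm
    have h1 := abs_limFun_sub_le h hn hx
    have h2 := hn k x hx
    rw [Real.dist_eq]
    rw [abs_le] at h1 h2
    rw [abs_lt]
    constructor <;> linarith
  exact hu.continuousOn (Frequently.of_forall hc)

/-! ### Harmonic functions with given corner values -/

/-- The values of the harmonic extension at the ten vertices of the first level. -/
def ext (a : Fin 3 → ℝ) : Fin 10 → ℝ :=
  ![a 0, a 1, a 2, (a 0 + a 1 + a 2) / 3,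
    (8 * a 0 + 4 * a 1 + 3 * a 2) / 15, (4 * a 0 + 8 * a 1 + 3 * a 2) / 15,
    (3 * a 0 + 8 * a 1 + 4 * a 2) / 15, (3 * a 0 + 4 * a 1 + 8 * a 2) / 15,
    (4 * a 0 + 3 * a 1 + 8 * a 2) / 15, (8 * a 0 + 3 * a 1 + 4 * a 2) / 15]

/-- The corner values of the harmonic extension on the cell `F_i K`. -/
def sub (a : Fin 3 → ℝ) (i : Fin 6) (j : Fin 3) : ℝ := ext a (vertexIndex i j)

/-- Approximations of a harmonic function: affine on the cells of level `n`. -/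
def harmApprox (hq : AffineIndependent ℝ q) : ℕ → (Fin 3 → ℝ) → Plane → ℝ
  | 0, a => fun x => ∑ k, a k * bary hq k x
  | n + 1, a => glue q fun i => harmApprox hq n (sub a i)

lemma harmApprox_corner (hq : AffineIndependent ℝ q) (n : ℕ) (a : Fin 3 → ℝ) (k : Fin 3) :
    harmApprox hq n a (q k) = a k := by
  induction n generalizing a k with
  | zero => simp [harmApprox, bary_corner]
  | succ n ih =>
    obtain ⟨h0, h1, h2⟩ := glue_corner hq (g := fun i => harmApprox hq n (sub a i)) (ext a)
      fun i b => ih (sub a i) b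
    fin_cases k
    exacts [h0, h1, h2]

lemma harmApprox_F (hq : AffineIndependent ℝ q) (n : ℕ) (a : Fin 3 → ℝ) (i : Fin 6) {x : Plane}
    (hx : x ∈ gasket q) : harmApprox hq (n + 1) a (F q i x) = harmApprox hq n (sub a i) x :=
  glue_F hq (ext a) (fun j b => harmApprox_corner hq n (sub a j) b) i hx

lemma harmApprox_continuousOn (hq : AffineIndependent ℝ q) (n : ℕ) (a : Fin 3 → ℝ) :
    ContinuousOn (harmApprox hq n a) (gasket q) := by
  induction n generalizing a with
  | zero =>
    exact (continuous_finsetSum _ fun k _ => continuous_const.mul (bary_continuous hq k)).continuousOn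
  | succ n ih =>
    exact glue_continuousOn hq (ext a) (fun j b => harmApprox_corner hq n (sub a j) b)
      fun i => ih (sub a i)

/-- Every entry of `ext` is a weighted mean of the corner values: the discrete maximum principle. -/
lemma le_sub {a : Fin 3 → ℝ} {l : ℝ} (h : ∀ k, l ≤ a k) (i : Fin 6) (j : Fin 3) : l ≤ sub a i j := by
  have h0 := h 0
  have h1 := h 1
  have h2 := h 2
  fin_cases i <;> fin_cases j <;> simp [sub, ext, vertexIndex] <;> linarith

lemma le_harmApprox (hq : AffineIndependent ℝ q) (n : ℕ) {a : Fin 3 → ℝ} {l : ℝ}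
    (h : ∀ k, l ≤ a k) {x : Plane} (hx : x ∈ gasket q) : l ≤ harmApprox hq n a x := by
  induction n generalizing a x with
  | zero =>
    have hs := sum_bary hq x
    simp only [Fin.sum_univ_three] at hs
    simp only [harmApprox, Fin.sum_univ_three]
    have h0 := mul_le_mul_of_nonneg_right (h 0) (bary_nonneg hq 0 hx)
    have h1 := mul_le_mul_of_nonneg_right (h 1) (bary_nonneg hq 1 hx)
    have h2 := mul_le_mul_of_nonneg_right (h 2) (bary_nonneg hq 2 hx)
    calc l = l * bary hq 0 x + l * bary hq 1 x + l * bary hq 2 x := by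
          rw [← mul_add, ← mul_add, hs, mul_one]
      _ ≤ _ := by linarith
  | succ n ih =>
    obtain ⟨i, y, hy, rfl⟩ := exists_F_eq hx
    rw [harmApprox_F hq n a i hy]
    exact ih (le_sub h i) hy

lemma sub_linear (c d : ℝ) (a b : Fin 3 → ℝ) (i : Fin 6) :
    sub (c • a + d • b) i = c • sub a i + d • sub b i := by
  funext j
  fin_cases i <;> fin_cases j <;> simp [sub, ext, vertexIndex] <;> ring

lemma harmApprox_linear (hq : AffineIndependent ℝ q) (n : ℕ) (c d : ℝ) (a b : Fin 3 → ℝ) {x : Plane}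
    (hx : x ∈ gasket q) :
    harmApprox hq n (c • a + d • b) x = c * harmApprox hq n a x + d * harmApprox hq n b x := by
  induction n generalizing a b x with
  | zero =>
    simp only [harmApprox, Fin.sum_univ_three, Pi.add_apply, Pi.smul_apply, smul_eq_mul]
    ring
  | succ n ih =>
    obtain ⟨i, y, hy, rfl⟩ := exists_F_eq hx
    simp only [harmApprox_F hq n _ i hy, sub_linear]
    exact ih _ _ hy

lemma harmApprox_le (hq : AffineIndependent ℝ q) (n : ℕ) {a : Fin 3 → ℝ} {l : ℝ}
    (h : ∀ k, a k ≤ l) {x : Plane} (hx : x ∈ gasket q) : harmApprox hq n a x ≤ l := by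
  have h1 := harmApprox_linear hq n (-1) 0 a a hx
  have h2 := le_harmApprox hq n (a := (-1 : ℝ) • a + (0 : ℝ) • a) (l := -l)
    (fun k => by simpa using h k) hx
  linarith

/-- The worst case is a corner cell: `a 0 - (8 a 0 + 4 a 1 + 3 a 2) / 15` is `(4 (a 0 - a 1) + 3 (a
0 - a 2)) / 15`. -/
lemma sub_osc {a : Fin 3 → ℝ} {R : ℝ} (h : ∀ i j, a i - a j ≤ R) (t : Fin 6) (i j : Fin 3) :
    sub a t i - sub a t j ≤ 7 / 15 * R := by
  have h0 := h 0 0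
  have h01 := h 0 1
  have h02 := h 0 2
  have h10 := h 1 0
  have h12 := h 1 2
  have h20 := h 2 0
  have h21 := h 2 1
  fin_cases t <;> fin_cases i <;> fin_cases j <;> simp [sub, ext, vertexIndex] <;> linarith

/-- At level zero both functions lie between the smallest corner value and that value plus `R`; each
further level contracts `R` by `7/15`. -/
lemma harmApprox_cauchy (hq : AffineIndependent ℝ q) (n k : ℕ) {a : Fin 3 → ℝ} {R : ℝ}
    (h : ∀ i j, a i - a j ≤ R) {x : Plane} (hx : x ∈ gasket q) :
    |harmApprox hq (n + k) a x - harmApprox hq n a x| ≤ (7 / 15) ^ n * R := by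
  induction n generalizing a R x with
  | zero =>
    obtain ⟨i, hi⟩ := Finite.exists_min a
    have h1 : ∀ k, a k ≤ a i + R := fun k => by linarith [h k i]
    have h2 := le_harmApprox hq (0 + k) hi hx
    have h3 := le_harmApprox hq 0 hi hx
    have h4 := harmApprox_le hq (0 + k) h1 hx
    have h5 := harmApprox_le hq 0 h1 hx
    rw [abs_le]
    constructor <;> linarith
  | succ n ih =>
    obtain ⟨i, y, hy, rfl⟩ := exists_F_eq hx
    rw [show n + 1 + k = n + k + 1 by ring, harmApprox_F hq _ a i hy, harmApprox_F hq _ a i hy]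
    refine (ih (sub_osc h i) hy).trans_eq ?_
    ring

lemma harmApprox_uniform (hq : AffineIndependent ℝ q) (a : Fin 3 → ℝ) :
    ∀ ε > 0, ∃ n, ∀ k, ∀ x ∈ gasket q, |harmApprox hq (n + k) a x - harmApprox hq n a x| ≤ ε := by
  intro ε hε
  obtain ⟨i, hi⟩ := Finite.exists_min a
  obtain ⟨j, hj⟩ := Finite.exists_max a
  have h1 : ∀ k l, a k - a l ≤ a j - a i := fun k l => by linarith [hi l, hj k]
  have h2 : Tendsto (fun n : ℕ => (7 / 15 : ℝ) ^ n * (a j - a i)) atTop (𝓝 0) := by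
    simpa using (tendsto_pow_atTop_nhds_zero_of_lt_one (r := (7 / 15 : ℝ)) (by norm_num)
      (by norm_num)).mul_const (a j - a i)
  obtain ⟨n, hn⟩ := (h2.eventually (gt_mem_nhds hε)).exists
  exact ⟨n, fun k x hx => (harmApprox_cauchy hq n k h1 hx).trans hn.le⟩

/-- The harmonic function with corner values `a`. -/
def harm (hq : AffineIndependent ℝ q) (a : Fin 3 → ℝ) : Plane → ℝ :=
  limFun fun n => harmApprox hq n a

lemma harm_tendsto (hq : AffineIndependent ℝ q) (a : Fin 3 → ℝ) {x : Plane} (hx : x ∈ gasket q) :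
    Tendsto (fun n => harmApprox hq n a x) atTop (𝓝 (harm hq a x)) :=
  limFun_tendsto (harmApprox_uniform hq a) hx

lemma harm_continuousOn (hq : AffineIndependent ℝ q) (a : Fin 3 → ℝ) :
    ContinuousOn (harm hq a) (gasket q) :=
  limFun_continuousOn (harmApprox_uniform hq a) fun n => harmApprox_continuousOn hq n a

lemma harm_corner (hq : AffineIndependent ℝ q) (a : Fin 3 → ℝ) (k : Fin 3) :
    harm hq a (q k) = a k := by
  refine tendsto_nhds_unique (harm_tendsto hq a (corner_mem k)) ?_
  simp only [harmApprox_corner]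
  exact tendsto_const_nhds

lemma harm_F (hq : AffineIndependent ℝ q) (a : Fin 3 → ℝ) (i : Fin 6) {x : Plane}
    (hx : x ∈ gasket q) : harm hq a (F q i x) = harm hq (sub a i) x := by
  refine tendsto_nhds_unique
    ((harm_tendsto hq a (F_mem i hx)).comp (tendsto_add_atTop_nat 1)) ?_
  refine (harm_tendsto hq (sub a i) hx).congr fun n => ?_
  exact (harmApprox_F hq n a i hx).symm

lemma le_harm (hq : AffineIndependent ℝ q) {a : Fin 3 → ℝ} {l : ℝ} (h : ∀ k, l ≤ a k) {x : Plane}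
    (hx : x ∈ gasket q) : l ≤ harm hq a x :=
  ge_of_tendsto' (harm_tendsto hq a hx) fun n => le_harmApprox hq n h hx

lemma harm_le (hq : AffineIndependent ℝ q) {a : Fin 3 → ℝ} {l : ℝ} (h : ∀ k, a k ≤ l) {x : Plane}
    (hx : x ∈ gasket q) : harm hq a x ≤ l :=
  le_of_tendsto' (harm_tendsto hq a hx) fun n => harmApprox_le hq n h hx

lemma harm_linear (hq : AffineIndependent ℝ q) (c d : ℝ) (a b : Fin 3 → ℝ) {x : Plane}
    (hx : x ∈ gasket q) :
    harm hq (c • a + d • b) x = c * harm hq a x + d * harm hq b x := by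
  refine tendsto_nhds_unique (harm_tendsto hq _ hx) ?_
  simp only [harmApprox_linear hq _ c d a b hx]
  exact ((harm_tendsto hq a hx).const_mul c).add ((harm_tendsto hq b hx).const_mul d)

lemma harm_const (hq : AffineIndependent ℝ q) {a : Fin 3 → ℝ} {c : ℝ} (h : ∀ k, a k = c)
    {x : Plane} (hx : x ∈ gasket q) : harm hq a x = c :=
  le_antisymm (harm_le hq (fun k => (h k).le) hx) (le_harm hq (fun k => (h k).ge) hx)

/-! ### Vertices and cells -/

lemma V_succ_subset (m : ℕ) : V q m ⊆ V q (m + 1) := by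
  induction m with
  | zero =>
    rintro _ ⟨i, rfl⟩
    obtain ⟨j, hj⟩ := F_corner q i
    exact mem_iUnion.2 ⟨j, q i, mem_range_self i, hj⟩
  | succ m ih =>
    intro x hx
    obtain ⟨i, y, hy, rfl⟩ := mem_iUnion.1 hx
    exact mem_iUnion.2 ⟨i, y, ih hy, rfl⟩

lemma V_mono {m n : ℕ} (h : m ≤ n) : V q m ⊆ V q n :=
  monotone_nat_of_le_succ (f := V q) V_succ_subset h

lemma corner_mem_V (m : ℕ) (k : Fin 3) : q k ∈ V q m := V_mono (Nat.zero_le m) (mem_range_self k)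

lemma F_mem_V {m : ℕ} (i : Fin 6) {x : Plane} (hx : x ∈ V q m) : F q i x ∈ V q (m + 1) :=
  mem_iUnion.2 ⟨i, x, hx, rfl⟩

/-- The `V_m` increase, so a bound known on high levels only still holds on a dense set. -/
lemma le_of_le_on_V {u : Plane → ℝ} {c : ℝ} (hu : ContinuousOn u (gasket q)) (m₀ : ℕ)
    (h : ∀ m ≥ m₀, ∀ x ∈ V q m, u x ≤ c) {x : Plane} (hx : x ∈ gasket q) : u x ≤ c := by
  refine le_on_closure (s := ⋃ m, V q m) (f := u) (g := fun _ => c) ?_ hu continuousOn_const hx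
  intro y hy
  obtain ⟨m, hm⟩ := mem_iUnion.1 hy
  exact h (max m m₀) (le_max_right _ _) y (V_mono (le_max_left _ _) hm)

lemma eqOn_of_eqOn_V {u v : Plane → ℝ} (hu : ContinuousOn u (gasket q))
    (hv : ContinuousOn v (gasket q)) (h : ∀ m, EqOn u v (V q m)) : EqOn u v (gasket q) := by
  intro x hx
  have h1 : u x - v x ≤ 0 :=
    le_of_le_on_V (hu.sub hv) 0 (fun m _ y hy => (sub_eq_zero.2 (h m hy)).le) hx
  have h2 : v x - u x ≤ 0 :=
    le_of_le_on_V (hv.sub hu) 0 (fun m _ y hy => (sub_eq_zero.2 (h m hy).symm).le) hx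
  linarith

lemma Fw_mem (w : List (Fin 6)) {x : Plane} (hx : x ∈ gasket q) : Fw q w x ∈ gasket q := by
  induction w with
  | nil => exact hx
  | cons i w ih => exact F_mem i ih

lemma Fw_dist (w : List (Fin 6)) (x y : Plane) :
    dist (Fw q w x) (Fw q w y) = (1 / 3) ^ w.length * dist x y := by
  induction w with
  | nil => simp [Fw]
  | cons i w ih =>
    simp only [Fw, Function.comp_apply, F_dist, ih, List.length_cons, pow_succ]
    ring

lemma Fw_continuous (w : List (Fin 6)) : Continuous (Fw q w) := by
  induction w with
  | nil => exact continuous_id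
  | cons i w ih => exact (F_continuous q i).comp ih

lemma exists_Fw_eq (m : ℕ) {x : Plane} (hx : x ∈ gasket q) :
    ∃ w : List (Fin 6), w.length = m ∧ ∃ y ∈ gasket q, Fw q w y = x := by
  induction m generalizing x with
  | zero => exact ⟨[], rfl, x, hx, rfl⟩
  | succ m ih =>
    obtain ⟨i, y, hy, rfl⟩ := exists_F_eq hx
    obtain ⟨w, hw, z, hz, rfl⟩ := ih hy
    exact ⟨i :: w, by simp [hw], z, hz, rfl⟩

lemma exists_Fw_corner {m : ℕ} {x : Plane} (hx : x ∈ V q m) :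
    ∃ w : List (Fin 6), w.length = m ∧ ∃ a, Fw q w (q a) = x := by
  induction m generalizing x with
  | zero =>
    obtain ⟨a, rfl⟩ := hx
    exact ⟨[], rfl, a, rfl⟩
  | succ m ih =>
    obtain ⟨i, y, hy, rfl⟩ := mem_iUnion.1 hx
    obtain ⟨w, hw, a, rfl⟩ := ih hy
    exact ⟨i :: w, by simp [hw], a, rfl⟩

lemma Fw_corner_mem_V (w : List (Fin 6)) (a : Fin 3) : Fw q w (q a) ∈ V q w.length := by
  induction w with
  | nil => exact mem_range_self a
  | cons i w ih => exact F_mem_V i ih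

/-- Cells of high level are uniformly small. -/
lemma exists_cell_small (q : Fin 3 → Plane) {δ : ℝ} (hδ : 0 < δ) :
    ∃ m₀, ∀ w : List (Fin 6), m₀ ≤ w.length → ∀ x ∈ gasket q, ∀ y ∈ gasket q,
      dist (Fw q w x) (Fw q w y) < δ := by
  set D := Metric.diam (gasket q)
  have h2 : Tendsto (fun n : ℕ => (1 / 3 : ℝ) ^ n * D) atTop (𝓝 0) := by
    simpa using (tendsto_pow_atTop_nhds_zero_of_lt_one (r := (1 / 3 : ℝ)) (by norm_num)
      (by norm_num)).mul_const D
  obtain ⟨m₀, hm⟩ := eventually_atTop.1 (h2.eventually (gt_mem_nhds hδ))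
  refine ⟨m₀, fun w hw x hx y hy => ?_⟩
  rw [Fw_dist]
  refine lt_of_le_of_lt ?_ (hm _ hw)
  exact mul_le_mul_of_nonneg_left
    (Metric.dist_le_diam_of_mem (gasket_compact q).isBounded hx hy) (by positivity)

/-! ### The graph energies -/

/-- The energy form of a triangle. -/
def tri (a b : Fin 3 → ℝ) : ℝ := ∑ i : Fin 3, (a i - a (i + 1)) * (b i - b (i + 1))

lemma energy_zero (u v : Plane → ℝ) : energy q 0 u v = tri (u ∘ q) (v ∘ q) := by
  simp [energy, tri, Fw]

lemma energy_succ (m : ℕ) (u v : Plane → ℝ) :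
    energy q (m + 1) u v = 15 / 7 * ∑ i, energy q m (u ∘ F q i) (v ∘ F q i) := by
  unfold energy
  rw [← (Fin.consEquiv fun _ : Fin (m + 1) => Fin 6).sum_comp, Fintype.sum_prod_type,
    ← Finset.mul_sum, ← mul_assoc]
  congr 1
  · rw [pow_succ]
    field_simp
  · simp only [Fin.consEquiv, Equiv.coe_fn_mk, List.ofFn_cons, Fw, Function.comp_apply]

lemma energy_congr {m : ℕ} {u u' v v' : Plane → ℝ} (hu : EqOn u u' (V q m))
    (hv : EqOn v v' (V q m)) : energy q m u v = energy q m u' v' := by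
  unfold energy
  congr 1
  refine Finset.sum_congr rfl fun w _ => Finset.sum_congr rfl fun i _ => ?_
  have h : ∀ a, Fw q (List.ofFn w) (q a) ∈ V q m := fun a => by
    simpa using Fw_corner_mem_V (q := q) (List.ofFn w) a
  rw [hu (h _), hu (h _), hv (h _), hv (h _)]

lemma energy_comm (m : ℕ) (u v : Plane → ℝ) : energy q m u v = energy q m v u := by
  simp only [energy, mul_comm]

lemma energy_sub_left (m : ℕ) (u u' v : Plane → ℝ) :
    energy q m (fun x => u x - u' x) v = energy q m u v - energy q m u' v := by
  simp only [energy]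
  rw [← mul_sub, ← Finset.sum_sub_distrib]
  congr 1
  refine Finset.sum_congr rfl fun w _ => ?_
  rw [← Finset.sum_sub_distrib]
  exact Finset.sum_congr rfl fun i _ => by ring

lemma energy_sub_sub (m : ℕ) (u v : Plane → ℝ) :
    energy q m (fun x => u x - v x) (fun x => u x - v x) =
      energy q m u u - 2 * energy q m u v + energy q m v v := by
  rw [energy_sub_left, energy_comm m u, energy_comm m v, energy_sub_left, energy_sub_left,
    energy_comm m v u]
  ring

lemma energy_neg_left (m : ℕ) (u v : Plane → ℝ) :
    energy q m (fun x => -u x) v = -energy q m u v := by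
  have h := energy_sub_left (q := q) m (fun _ => 0) u v
  simp only [zero_sub] at h
  rw [h]
  simp [energy]

lemma energy_self_nonneg (m : ℕ) (u : Plane → ℝ) : 0 ≤ energy q m u u :=
  mul_nonneg (by positivity) (Finset.sum_nonneg fun _ _ => Finset.sum_nonneg fun _ _ =>
    mul_self_nonneg _)

/-- Truncation from below decreases the energy. -/
lemma energy_truncate_le (m : ℕ) (u : Plane → ℝ) (c : ℝ) :
    energy q m (fun x => max (u x - c) 0) (fun x => max (u x - c) 0) ≤
      energy q m u fun x => max (u x - c) 0 := by
  -- Truncation is nondecreasing and 1-Lipschitz, so this holds edge by edge.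
  have key : ∀ a b : ℝ, (max (a - c) 0 - max (b - c) 0) * (max (a - c) 0 - max (b - c) 0) ≤
      (a - b) * (max (a - c) 0 - max (b - c) 0) := by
    intro a b
    rcases le_total (a - c) 0 with h1 | h1 <;> rcases le_total (b - c) 0 with h2 | h2 <;>
      simp only [max_eq_left, max_eq_right, h1, h2] <;> nlinarith
  exact mul_le_mul_of_nonneg_left (Finset.sum_le_sum fun _ _ => Finset.sum_le_sum fun _ _ =>
    key _ _) (by positivity)

/-- A function without energy is constant. -/
lemma eq_const_of_energy_nonpos {m : ℕ} {v : Plane → ℝ} (h : energy q m v v ≤ 0) :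
    ∃ c, ∀ x ∈ V q m, v x = c := by
  induction m generalizing v with
  | zero =>
    rw [energy_zero] at h
    simp only [tri, Fin.sum_univ_three, Function.comp_apply] at h
    refine ⟨v (q 0), ?_⟩
    rintro _ ⟨k, rfl⟩
    change (v (q 0) - v (q 1)) * (v (q 0) - v (q 1)) + (v (q 1) - v (q 2)) * (v (q 1) - v (q 2)) +
      (v (q 2) - v (q 0)) * (v (q 2) - v (q 0)) ≤ 0 at h
    have h1 := mul_self_nonneg (v (q 0) - v (q 1))
    have h2 := mul_self_nonneg (v (q 1) - v (q 2))
    have h3 := mul_self_nonneg (v (q 2) - v (q 0))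
    have e1 := mul_self_eq_zero.1 (le_antisymm (by linarith) h1)
    have e3 := mul_self_eq_zero.1 (le_antisymm (by linarith) h3)
    fin_cases k
    · rfl
    · exact (sub_eq_zero.1 e1).symm
    · exact sub_eq_zero.1 e3
  | succ m ih =>
    rw [energy_succ] at h
    have h0 : ∀ i, energy q m (v ∘ F q i) (v ∘ F q i) ≤ 0 := fun i => by
      have := Finset.single_le_sum (f := fun i => energy q m (v ∘ F q i) (v ∘ F q i))
        (fun i _ => energy_self_nonneg m _) (Finset.mem_univ i)
      linarith
    choose c hc using fun i => ih (h0 i)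
    have e : ∀ i a, v (vertex q (vertexIndex i a)) = c i := fun i a => by
      rw [← F_eq_vertex]
      exact hc i (q a) (corner_mem_V m a)
    -- The constants agree through shared vertices: cell 5 touches the cells 0, 1, 3, 4, and cell 4
    -- touches cell 2.
    have e5 : c 5 = c 0 := (e 5 0).symm.trans (e 0 1)
    have e1 : c 1 = c 5 := (e 1 0).symm.trans (e 5 1)
    have e4 : c 4 = c 5 := (e 4 1).symm.trans (e 5 2)
    have e3 : c 3 = c 5 := (e 3 0).symm.trans (e 5 2)
    have e2 : c 2 = c 4 := (e 2 0).symm.trans (e 4 2)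
    refine ⟨c 0, fun x hx => ?_⟩
    obtain ⟨i, y, hy, rfl⟩ := mem_iUnion.1 hx
    refine (hc i y hy).trans ?_
    fin_cases i
    · rfl
    · exact e1.trans e5
    · exact e2.trans (e4.trans e5)
    · exact e3.trans e5
    · exact e4.trans e5
    · exact e5

/-- `ext b` satisfies the flux balance at the seven inner vertices, so the values of `U` there drop
out; `15/7` normalizes what remains at the corners. -/
lemma tri_ext (U : Fin 10 → ℝ) (b : Fin 3 → ℝ) :
    15 / 7 * ∑ i, tri (fun j => U (vertexIndex i j)) (sub b i) = tri (![U 0, U 1, U 2]) b := by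
  simp [tri, Fin.sum_univ_six, Fin.sum_univ_three, sub, ext, vertexIndex]
  ring

/-- Only the corner values of `u` enter, on every level: `tri_ext` applied cell by cell. -/
lemma energy_harm (hq : AffineIndependent ℝ q) (n : ℕ) (u : Plane → ℝ) (a : Fin 3 → ℝ) :
    energy q n u (harm hq a) = tri (u ∘ q) a := by
  induction n generalizing u a with
  | zero =>
    rw [energy_zero]
    congr 1
    funext k
    exact harm_corner hq a k
  | succ n ih =>
    have h1 : ∀ i, energy q n (u ∘ F q i) (harm hq a ∘ F q i) =
        tri (fun j => u (vertex q (vertexIndex i j))) (sub a i) := fun i => by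
      simp only [← F_eq_vertex]
      exact (energy_congr (fun _ _ => rfl) fun x hx => harm_F hq a i (V_subset n hx)).trans (ih _ _)
    rw [energy_succ, Finset.sum_congr rfl fun i _ => h1 i, tri_ext fun n => u (vertex q n)]
    congr 1
    obtain ⟨e0, e1, e2⟩ := F_corner_self q
    funext k
    fin_cases k
    · exact congrArg u e0
    · exact congrArg u e1
    · exact congrArg u e2

/-- The difference between `u` and the harmonic function with its corner values has nonnegative
energy; expanding the square gives the first level, and self-similarity the others. -/
lemma energy_le_succ (hq : AffineIndependent ℝ q) (m : ℕ) (u : Plane → ℝ) :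
    energy q m u u ≤ energy q (m + 1) u u := by
  induction m generalizing u with
  | zero =>
    have h1 := energy_self_nonneg (q := q) 1 fun x => u x - harm hq (u ∘ q) x
    rw [energy_sub_sub, energy_harm, energy_harm] at h1
    have h2 : harm hq (u ∘ q) ∘ q = u ∘ q := funext fun k => harm_corner hq _ k
    rw [h2] at h1
    rw [energy_zero]
    norm_num at h1 ⊢
    linarith
  | succ m ih =>
    rw [energy_succ, energy_succ]
    exact mul_le_mul_of_nonneg_left (Finset.sum_le_sum fun i _ => ih _) (by norm_num)

/-! ### Splines -/

/-- The piecewise harmonic function of level `m` with the values of `u` on `V_m`. -/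
def spline (hq : AffineIndependent ℝ q) : ℕ → (Plane → ℝ) → Plane → ℝ
  | 0, u => harm hq (u ∘ q)
  | m + 1, u => glue q fun i => spline hq m (u ∘ F q i)

lemma spline_corner (hq : AffineIndependent ℝ q) (m : ℕ) (u : Plane → ℝ) (k : Fin 3) :
    spline hq m u (q k) = u (q k) := by
  induction m generalizing u k with
  | zero => exact harm_corner hq _ k
  | succ m ih =>
    obtain ⟨h0, h1, h2⟩ := glue_corner hq (g := fun i => spline hq m (u ∘ F q i))
      (fun n => u (vertex q n)) fun i a => by rw [ih, ← F_eq_vertex]; rfl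
    obtain ⟨e0, e1, e2⟩ := F_corner_self q
    fin_cases k
    · exact h0.trans (congrArg u e0)
    · exact h1.trans (congrArg u e1)
    · exact h2.trans (congrArg u e2)

lemma spline_val (hq : AffineIndependent ℝ q) (m : ℕ) (u : Plane → ℝ) (i : Fin 6) (a : Fin 3) :
    spline hq m (u ∘ F q i) (q a) = u (vertex q (vertexIndex i a)) := by
  rw [spline_corner, ← F_eq_vertex]
  rfl

lemma spline_F (hq : AffineIndependent ℝ q) (m : ℕ) (u : Plane → ℝ) (i : Fin 6) {x : Plane}
    (hx : x ∈ gasket q) : spline hq (m + 1) u (F q i x) = spline hq m (u ∘ F q i) x :=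
  glue_F hq (fun n => u (vertex q n)) (fun i a => spline_val hq m u i a) i hx

lemma spline_continuousOn (hq : AffineIndependent ℝ q) (m : ℕ) (u : Plane → ℝ) :
    ContinuousOn (spline hq m u) (gasket q) := by
  induction m generalizing u with
  | zero => exact harm_continuousOn hq _
  | succ m ih =>
    exact glue_continuousOn hq (fun n => u (vertex q n)) (fun i a => spline_val hq m u i a)
      fun i => ih _

lemma spline_eqOn (hq : AffineIndependent ℝ q) (m : ℕ) (u : Plane → ℝ) :
    EqOn (spline hq m u) u (V q m) := by
  induction m generalizing u with
  | zero =>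
    rintro _ ⟨k, rfl⟩
    exact harm_corner hq _ k
  | succ m ih =>
    intro x hx
    obtain ⟨i, y, hy, rfl⟩ := mem_iUnion.1 hx
    rw [spline_F hq m u i (V_subset m hy), ih _ hy]
    rfl

lemma spline_Fw (hq : AffineIndependent ℝ q) (w : List (Fin 6)) (u : Plane → ℝ) {x : Plane}
    (hx : x ∈ gasket q) : spline hq w.length u (Fw q w x) = harm hq (u ∘ Fw q w ∘ q) x := by
  induction w generalizing u with
  | nil => rfl
  | cons i w ih => exact (spline_F hq _ u i (Fw_mem w hx)).trans (ih (u ∘ F q i))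

/-- Splines make a level-`m` pairing persist on all finer levels, which turns a limit of energies
into an identity on one level. -/
lemma energy_spline (hq : AffineIndependent ℝ q) (m n : ℕ) (u v : Plane → ℝ) :
    energy q (m + n) u (spline hq m v) = energy q m u v := by
  induction m generalizing u v with
  | zero => rw [energy_zero, zero_add]; exact energy_harm hq n u _
  | succ m ih =>
    rw [show m + 1 + n = m + n + 1 by ring, energy_succ, energy_succ]
    congr 1
    refine Finset.sum_congr rfl fun i _ => ?_
    rw [← ih]
    exact energy_congr (fun _ _ => rfl) fun x hx => spline_F hq m v i (V_subset _ hx)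

lemma bddAbove_of_eventually_le {a : ℕ → ℝ} (hm : Monotone a) {m : ℕ} {C : ℝ}
    (h : ∀ n, a (m + n) ≤ C) : BddAbove (range a) := by
  refine ⟨C, ?_⟩
  rintro _ ⟨k, rfl⟩
  exact (hm (Nat.le_add_left k m)).trans (h k)

lemma memDom_spline (hq : AffineIndependent ℝ q) (m : ℕ) (u : Plane → ℝ) :
    MemDom q (spline hq m u) := by
  refine ⟨spline_continuousOn hq m u, bddAbove_of_eventually_le
    (monotone_nat_of_le_succ fun k => energy_le_succ hq k _) (m := m) (C := energy q m u u)
    fun n => ?_⟩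
  rw [energy_spline]
  exact (energy_congr (spline_eqOn hq m u) fun _ _ => rfl).le

lemma memDom_of_eqOn_harm (hq : AffineIndependent ℝ q) {u : Plane → ℝ} {a : Fin 3 → ℝ}
    (h : EqOn u (harm hq a) (gasket q)) : MemDom q u := by
  refine ⟨(harm_continuousOn hq a).congr h, tri a a, ?_⟩
  rintro _ ⟨m, rfl⟩
  refine (energy_congr (fun x hx => h (V_subset m hx)) fun x hx => h (V_subset m hx)).le.trans ?_
  rw [energy_harm]
  exact (congrArg (tri · a) (funext fun k => harm_corner hq a k)).le

/-! ### Harmonic functions -/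

lemma isHarmonic_of_eqOn_harm (hq : AffineIndependent ℝ q) {u : Plane → ℝ} {a : Fin 3 → ℝ}
    (h : EqOn u (harm hq a) (gasket q)) : IsHarmonic q u := by
  refine ⟨(harm_continuousOn hq a).congr h, fun m g hg => ?_⟩
  have h1 : ∀ m, energy q m u u = tri a a := fun m => by
    rw [energy_congr (fun x hx => h (V_subset m hx)) fun x hx => h (V_subset m hx), energy_harm]
    exact congrArg (tri · a) (funext fun k => harm_corner hq a k)
  rw [h1, ← h1 m, ← energy_congr hg hg]
  exact energy_le_succ hq m g

/-- Comparison with the spline shows that the energies of `h` do not grow with the level. Hence `h -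
harm` has no energy on any level; it is constant on `V_m`, and zero at `q 0`. -/
lemma IsHarmonic.eqOn_harm (hq : AffineIndependent ℝ q) {h : Plane → ℝ} (hh : IsHarmonic q h) :
    EqOn h (harm hq (h ∘ q)) (gasket q) := by
  have h1 : ∀ m, energy q m h h ≤ tri (h ∘ q) (h ∘ q) := by
    intro m
    induction m with
    | zero => exact (energy_zero h h).le
    | succ m ih =>
      refine (hh.2 m (spline hq m h) (spline_eqOn hq m h)).trans (le_trans (le_of_eq ?_) ih)
      rw [energy_spline]
      exact energy_congr (spline_eqOn hq m h) fun _ _ => rfl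
  refine eqOn_of_eqOn_V hh.1 (harm_continuousOn hq _) fun m x hx => ?_
  have h2 : energy q m (fun x => h x - harm hq (h ∘ q) x) (fun x => h x - harm hq (h ∘ q) x) ≤ 0 := by
    rw [energy_sub_sub, energy_harm, energy_harm]
    have : harm hq (h ∘ q) ∘ q = h ∘ q := funext fun k => harm_corner hq _ k
    rw [this]
    linarith [h1 m]
  obtain ⟨c, hc⟩ := eq_const_of_energy_nonpos h2
  have h3 := hc _ (corner_mem_V m 0)
  rw [harm_corner, Function.comp_apply, sub_self] at h3
  have h4 := hc x hx
  linarith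

lemma IsHarmonic.eqOn (hq : AffineIndependent ℝ q) {g h : Plane → ℝ} (hg : IsHarmonic q g)
    (hh : IsHarmonic q h) (h0 : EqOn g h (V q 0)) : EqOn g h (gasket q) := by
  have e : g ∘ q = h ∘ q := funext fun k => h0 (mem_range_self k)
  intro x hx
  rw [hg.eqOn_harm hq hx, hh.eqOn_harm hq hx, e]

/-! ### Weakly harmonic functions on subsets of the gasket -/

/-- `v` vanishes at the corners of all `m`-cells that are not contained in `U`. -/
def Vanish (q : Fin 3 → Plane) (U : Set Plane) (m : ℕ) (v : Plane → ℝ) : Prop :=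
  ∀ w : List (Fin 6), w.length = m → ¬ Fw q w '' gasket q ⊆ U → ∀ a, v (Fw q w (q a)) = 0

/-- Harmonicity in `U`, tested on each level with the functions on vertices of `m`-cells in `U`. -/
def IsWeak (q : Fin 3 → Plane) (U : Set Plane) (u : Plane → ℝ) : Prop :=
  ∀ m v, Vanish q U m v → energy q m u v = 0

/-- The spline of `v` is an admissible test function, and its energies against `u` are constant from
level `m` on, hence equal to their limit zero. -/
lemma HarmonicIn.isWeak (hq : AffineIndependent ℝ q) {U : Set Plane} {u : Plane → ℝ}
    (hu : HarmonicIn q U u) : IsWeak q U u := by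
  intro m v hv
  set W : Set (List (Fin 6)) := {w | w.length = m ∧ Fw q w '' gasket q ⊆ U}
  have hW : W.Finite := (List.finite_length_eq (Fin 6) m).subset fun w hw => hw.1
  have hcl : IsClosed (⋃ w ∈ W, Fw q w '' gasket q) :=
    hW.isClosed_biUnion fun w _ => ((gasket_compact q).image (Fw_continuous w)).isClosed
  have h1 := hu.2 (spline hq m v) (memDom_spline hq m v) ?_
  · have h2 := h1.comp (tendsto_add_atTop_nat m)
    have h3 : (fun k => energy q k u (spline hq m v)) ∘ (fun k => k + m) =
        fun _ => energy q m u v := by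
      funext k
      simp only [Function.comp_apply]
      rw [add_comm, energy_spline]
    rw [h3] at h2
    exact tendsto_nhds_unique tendsto_const_nhds h2
  -- On an `m`-cell not inside `U` the spline has zero corner values and vanishes, so its support
  -- lies in the finitely many closed cells inside `U`.
  · refine (closure_minimal ?_ hcl).trans (iUnion₂_subset fun w hw => hw.2)
    rintro x ⟨hx, hvx⟩
    obtain ⟨w, rfl, y, hy, rfl⟩ := exists_Fw_eq m hx
    refine mem_biUnion (x := w) ⟨rfl, ?_⟩ (mem_image_of_mem _ hy)
    by_contra hn
    refine hvx ?_
    rw [spline_Fw hq w v hy]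
    exact harm_const hq (fun k => hv w rfl hn k) hy

/-- The closed support has positive distance from `Z`; a small cell leaving `U` meets `Z` and
therefore misses the support. -/
lemma vanish_eventually {U Z : Set Plane} (hZ : IsCompact Z) (hUZ : gasket q \ U ⊆ Z) {v : Plane → ℝ}
    (hv : closure {x ∈ gasket q | v x ≠ 0} ∩ Z = ∅) : ∃ m₀, ∀ m ≥ m₀, Vanish q U m v := by
  obtain ⟨δ, hδ, hd⟩ := hZ.exists_cthickening_subset_open
    (isClosed_closure (s := {x ∈ gasket q | v x ≠ 0})).isOpen_compl
    (by
      rw [subset_compl_iff_disjoint_left, disjoint_iff_inter_eq_empty]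
      exact hv)
  obtain ⟨m₀, hm⟩ := exists_cell_small q hδ
  refine ⟨m₀, ?_⟩
  rintro m hmm w rfl hw a
  by_contra hne
  obtain ⟨_, ⟨y, hy, rfl⟩, hyU⟩ := not_subset.1 hw
  have h1 : Fw q w (q a) ∈ Metric.cthickening δ Z :=
    Metric.mem_cthickening_of_dist_le _ (Fw q w y) _ _ (hUZ ⟨Fw_mem w hy, hyU⟩)
      (hm w hmm _ (corner_mem a) _ hy).le
  exact hd h1 (subset_closure ⟨Fw_mem w (corner_mem a), hne⟩)

lemma energy_eq_of_vanish {U : Set Plane} {m : ℕ} {u u' v : Plane → ℝ} (h : EqOn u u' U)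
    (hv : Vanish q U m v) : energy q m u v = energy q m u' v := by
  unfold energy
  congr 1
  refine Finset.sum_congr rfl fun w _ => Finset.sum_congr rfl fun i _ => ?_
  by_cases hw : Fw q (List.ofFn w) '' gasket q ⊆ U
  · rw [h (hw (mem_image_of_mem _ (corner_mem _))), h (hw (mem_image_of_mem _ (corner_mem _)))]
  · rw [hv _ (by simp) hw, hv _ (by simp) hw]
    ring

lemma IsWeak.congr {U : Set Plane} {u u' : Plane → ℝ} (hu : IsWeak q U u) (h : EqOn u' u U) :
    IsWeak q U u' :=
  fun m v hv => (energy_eq_of_vanish h hv).trans (hu m v hv)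

lemma IsWeak.sub {U : Set Plane} {u u' : Plane → ℝ} (hu : IsWeak q U u) (hu' : IsWeak q U u') :
    IsWeak q U fun x => u x - u' x := by
  intro m v hv
  rw [energy_sub_left, hu m v hv, hu' m v hv, sub_self]

lemma IsWeak.neg {U : Set Plane} {u : Plane → ℝ} (hu : IsWeak q U u) : IsWeak q U fun x => -u x := by
  intro m v hv
  rw [energy_neg_left, hu m v hv, neg_zero]

/-- The test function is `max (d - ε) 0`. By uniform continuity it vanishes at the corners of small
cells that leave `U`; truncation leaves it without energy. -/
lemma IsWeak.le_zero {U : Set Plane} {d : Plane → ℝ} (hd : IsWeak q U d)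
    (hc : ContinuousOn d (gasket q)) (h0 : ∀ x ∈ gasket q \ U, d x = 0)
    (hU : (gasket q \ U).Nonempty) {x : Plane} (hx : x ∈ gasket q) : d x ≤ 0 := by
  refine le_of_forall_pos_le_add fun ε hε => ?_
  rw [zero_add]
  obtain ⟨δ, hδ, hδd⟩ := Metric.uniformContinuousOn_iff.1
    ((gasket_compact q).uniformContinuousOn_of_continuous hc) ε hε
  obtain ⟨m₀, hm⟩ := exists_cell_small q hδ
  refine le_of_le_on_V hc m₀ (fun m hmm y hy => ?_) hx
  have hv : Vanish q U m fun x => max (d x - ε) 0 := by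
    rintro w rfl hw a
    obtain ⟨_, ⟨z, hz, rfl⟩, hzU⟩ := not_subset.1 hw
    have h1 := hδd _ (Fw_mem w (corner_mem a)) _ (Fw_mem w hz) (hm w hmm _ (corner_mem a) _ hz)
    rw [h0 _ ⟨Fw_mem w hz, hzU⟩, Real.dist_eq, sub_zero] at h1
    exact max_eq_right (by linarith [(abs_lt.1 h1).2])
  have h1 := energy_truncate_le (q := q) m d ε
  rw [hd m _ hv] at h1
  obtain ⟨c, hcV⟩ := eq_const_of_energy_nonpos h1
  -- The constant is zero, since a cell through a point outside `U` has corners where the test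
  -- function vanishes.
  obtain ⟨z, hz⟩ := hU
  obtain ⟨w, rfl, t, ht, rfl⟩ := exists_Fw_eq m hz.1
  have h2 := hcV _ (Fw_corner_mem_V w 0)
  have h5 : max (d (Fw q w (q 0)) - ε) 0 = 0 :=
    hv w rfl (fun hs => hz.2 (hs (mem_image_of_mem _ ht))) 0
  have h3 := hcV y hy
  have h4 := le_max_left (d y - ε) 0
  linarith

/-- Weakly harmonic functions with zero boundary values vanish. -/
lemma IsWeak.eq_zero {U : Set Plane} {d : Plane → ℝ} (hd : IsWeak q U d)
    (hc : ContinuousOn d (gasket q)) (h0 : ∀ x ∈ gasket q \ U, d x = 0)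
    (hU : (gasket q \ U).Nonempty) {x : Plane} (hx : x ∈ gasket q) : d x = 0 := by
  refine le_antisymm (hd.le_zero hc h0 hU hx) ?_
  have := hd.neg.le_zero hc.neg (fun y hy => by rw [h0 y hy, neg_zero]) hU hx
  linarith

/-- Restricting a weakly harmonic function to a cell of the first level. -/
lemma IsWeak.comp_F (hq : AffineIndependent ℝ q) {U U' : Set Plane} {u : Plane → ℝ}
    (hu : IsWeak q U u) (j : Fin 6) (hU : ∀ x ∈ U', F q j x ∈ U) (hc : ∀ a, q a ∉ U') :
    IsWeak q U' (u ∘ F q j) := by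
  intro m v hv
  -- A corner of the gasket is a corner of some `m`-cell, which is not inside `U'` as it contains
  -- that corner.
  have hv0 : ∀ a, v (q a) = 0 := fun a => by
    obtain ⟨w, hw, b, hb⟩ := exists_Fw_corner (corner_mem_V (q := q) m a)
    rw [← hb]
    refine hv w hw (fun hs => hc a ?_) b
    rw [← hb]
    exact hs (mem_image_of_mem _ (corner_mem b))
  -- The test function is placed in the cell `j` and extended by zero.
  set g : Fin 6 → Plane → ℝ := fun i => if i = j then v else fun _ => 0
  have hg : ∀ i a, g i (q a) = (fun _ => 0 : Fin 10 → ℝ) (vertexIndex i a) := fun i a => by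
    by_cases h : i = j
    · simp [g, h, hv0]
    · simp [g, h]
  have hgF : ∀ i, ∀ x ∈ gasket q, glue q g (F q i x) = g i x := fun i x hx =>
    glue_F hq (fun _ => 0) hg i hx
  have h1 := hu (m + 1) (glue q g) ?_
  · rw [energy_succ, Finset.sum_eq_single j] at h1
    · rw [energy_congr (v' := v) (fun _ _ => rfl)] at h1
      · linarith
      · intro x hx
        simpa [g] using hgF j x (V_subset m hx)
    · intro i _ hij
      rw [energy_congr (v' := fun _ => 0) (fun _ _ => rfl)]
      · simp [energy]
      · intro x hx
        simpa [g, hij] using hgF i x (V_subset m hx)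
    · simp
  · intro w hw hs a
    obtain _ | ⟨i, w⟩ := w
    · simp at hw
    · have h2 := hgF i _ (Fw_mem w (corner_mem (q := q) a))
      refine h2.trans ?_
      by_cases h : i = j
      · simp only [g, h, if_true]
        refine hv w (by simpa using hw) (fun hs' => hs ?_) a
        rintro _ ⟨x, hx, rfl⟩
        rw [h]
        exact hU _ (hs' (mem_image_of_mem _ hx))
      · simp [g, h]

/-- Test functions vanish at the corners, and by `energy_harm` nothing else counts. -/
lemma isWeak_harm (hq : AffineIndependent ℝ q) {U : Set Plane} (hU : ∀ a, q a ∉ U)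
    (a : Fin 3 → ℝ) : IsWeak q U (harm hq a) := by
  intro m v hv
  have hv0 : ∀ a, v (q a) = 0 := fun a => by
    obtain ⟨w, hw, b, hb⟩ := exists_Fw_corner (corner_mem_V (q := q) m a)
    rw [← hb]
    refine hv w hw (fun hs => hU a ?_) b
    rw [← hb]
    exact hs (mem_image_of_mem _ (corner_mem b))
  rw [energy_comm, energy_harm]
  simp [tri, hv0]

/-- A continuous function that is weakly harmonic off the corners is harmonic. -/
lemma IsWeak.eqOn_harm (hq : AffineIndependent ℝ q) {u : Plane → ℝ}
    (hu : IsWeak q (gasket q \ V q 0) u) (hc : ContinuousOn u (gasket q)) :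
    EqOn u (harm hq (u ∘ q)) (gasket q) := by
  intro x hx
  have hcor : ∀ a, q a ∉ gasket q \ V q 0 := fun a h => h.2 (mem_range_self a)
  -- Subtracting the harmonic function with the same corner values leaves zero boundary values; no
  -- finite energy near the corners is needed.
  refine sub_eq_zero.1 ((hu.sub (isWeak_harm hq hcor (u ∘ q))).eq_zero
    (hc.sub (harm_continuousOn hq _)) ?_ ⟨q 0, corner_mem 0, hcor 0⟩ hx)
  rintro y ⟨hy, hyU⟩
  have hy0 : y ∈ V q 0 := by
    by_contra h
    exact hyU ⟨hy, h⟩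
  obtain ⟨a, rfl⟩ := hy0
  exact sub_eq_zero.2 (harm_corner hq (u ∘ q) a).symm

/-! ### The antisymmetric harmonic function -/

lemma ha_eqOn (hq : AffineIndependent ℝ q) : EqOn (ha q) (harm hq ![0, 1, -1]) (gasket q) := by
  have h : ∃ h, IsHarmonic q h ∧ h (q 0) = 0 ∧ h (q 1) = 1 ∧ h (q 2) = -1 :=
    ⟨harm hq ![0, 1, -1], isHarmonic_of_eqOn_harm hq fun _ _ => rfl, harm_corner hq _ 0,
      harm_corner hq _ 1, harm_corner hq _ 2⟩
  obtain ⟨h1, h2, h3, h4⟩ : IsHarmonic q (ha q) ∧ ha q (q 0) = 0 ∧ ha q (q 1) = 1 ∧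
    ha q (q 2) = -1 := Classical.epsilon_spec h
  have e : ha q ∘ q = ![0, 1, -1] := by
    funext k
    fin_cases k
    exacts [h2, h3, h4]
  rw [← e]
  exact h1.eqOn_harm hq

lemma ha_corner (hq : AffineIndependent ℝ q) (k : Fin 3) : ha q (q k) = ![0, 1, -1] k := by
  rw [ha_eqOn hq (corner_mem k), harm_corner]

lemma ha_continuousOn (hq : AffineIndependent ℝ q) : ContinuousOn (ha q) (gasket q) :=
  (harm_continuousOn hq _).congr (ha_eqOn hq)

lemma ha_le_one (hq : AffineIndependent ℝ q) {x : Plane} (hx : x ∈ gasket q) : ha q x ≤ 1 := by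
  rw [ha_eqOn hq hx]
  refine harm_le hq (fun k => ?_) hx
  fin_cases k <;> norm_num

lemma neg_one_le_ha (hq : AffineIndependent ℝ q) {x : Plane} (hx : x ∈ gasket q) :
    -1 ≤ ha q x := by
  rw [ha_eqOn hq hx]
  refine le_harm hq (fun k => ?_) hx
  fin_cases k <;> norm_num

lemma ha_F (hq : AffineIndependent ℝ q) (i : Fin 6) {x : Plane} (hx : x ∈ gasket q) :
    ha q (F q i x) = harm hq (sub ![0, 1, -1] i) x := by
  rw [ha_eqOn hq (F_mem i hx), harm_F hq _ i hx]

/-- The ratio of `ha ∘ F_i` and `ha` for `i = 0, 3`. -/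
def haRatio (i : Fin 6) : ℝ := if i = 0 then 1 / 15 else 4 / 15

lemma haRatio_pos (i : Fin 6) : 0 < haRatio i := by
  unfold haRatio
  split_ifs <;> norm_num

lemma haRatio_le (i : Fin 6) : haRatio i ≤ 4 / 15 := by
  unfold haRatio
  split_ifs <;> norm_num

/-- The cells 0 and 3 are symmetric about the axis, so the corner values of `ha` on them are again
multiples of `(0, 1, -1)`. This is the source of all self-similarity of `X` and `Ω`. -/
lemma ha_F_axis (hq : AffineIndependent ℝ q) {i : Fin 6} (hi : i = 0 ∨ i = 3) {x : Plane}
    (hx : x ∈ gasket q) : ha q (F q i x) = haRatio i * ha q x := by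
  have e : sub ![0, 1, -1] i = haRatio i • ![0, 1, -1] + (0 : ℝ) • ![0, 1, -1] := by
    funext k
    rcases hi with rfl | rfl <;> fin_cases k <;> simp [sub, ext, vertexIndex, haRatio] <;> norm_num
  rw [ha_F hq i hx, e, harm_linear hq _ _ _ _ hx, ← ha_eqOn hq hx, zero_mul, add_zero]

lemma ha_F_one (hq : AffineIndependent ℝ q) {x : Plane} (hx : x ∈ gasket q) :
    ha q (F q 1 x) = harm hq ![1 / 3, 1, 4 / 15] x := by
  rw [ha_F hq 1 hx]
  congr 1
  funext k
  fin_cases k <;> simp [sub, ext, vertexIndex] <;> norm_num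

lemma ha_F_five (hq : AffineIndependent ℝ q) {x : Plane} (hx : x ∈ gasket q) :
    ha q (F q 5 x) = harm hq ![1 / 15, 1 / 3, 0] x := by
  rw [ha_F hq 5 hx]
  congr 1
  funext k
  fin_cases k <;> simp [sub, ext, vertexIndex] <;> norm_num

lemma ha_F_two (hq : AffineIndependent ℝ q) {x : Plane} (hx : x ∈ gasket q) :
    ha q (F q 2 x) = -harm hq ![1 / 3, 4 / 15, 1] x := by
  have e : sub ![0, 1, -1] 2 = (-1 : ℝ) • ![1 / 3, 4 / 15, 1] + (0 : ℝ) • ![0, 1, -1] := by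
    funext k
    fin_cases k <;> simp [sub, ext, vertexIndex] <;> norm_num
  rw [ha_F hq 2 hx, e, harm_linear hq _ _ _ _ hx]
  ring

lemma ha_F_four (hq : AffineIndependent ℝ q) {x : Plane} (hx : x ∈ gasket q) :
    ha q (F q 4 x) = -harm hq ![1 / 15, 0, 1 / 3] x := by
  have e : sub ![0, 1, -1] 4 = (-1 : ℝ) • ![1 / 15, 0, 1 / 3] + (0 : ℝ) • ![0, 1, -1] := by
    funext k
    fin_cases k <;> simp [sub, ext, vertexIndex] <;> norm_num
  rw [ha_F hq 4 hx, e, harm_linear hq _ _ _ _ hx]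
  ring

/-! ### Strong maximum principle and the sign of `ha` on the first-level cells. -/

/-- The letter of the first-level cell at the corner `k`. -/
def cornerCell : Fin 3 → Fin 6 := ![0, 1, 2]

lemma F_cornerCell (q : Fin 3 → Plane) (k : Fin 3) : F q (cornerCell k) (q k) = q k := by
  obtain ⟨h0, h1, h2⟩ := F_corner_self q
  fin_cases k
  exacts [h0, h1, h2]

/-- A zero at the corner `k` only affects the cell at that corner, where by `sub_cornerCell` the
situation repeats. -/
lemma sub_pos_of_ne {a : Fin 3 → ℝ} {k : Fin 3} (h : ∀ j, j ≠ k → 0 < a j) (hk : 0 ≤ a k)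
    {i : Fin 6} (hi : i ≠ cornerCell k) (j : Fin 3) : 0 < sub a i j := by
  have h0 := h 0
  have h1 := h 1
  have h2 := h 2
  fin_cases k <;> simp at h0 h1 h2 hk <;> fin_cases i <;> first
    | exact absurd rfl hi
    | (fin_cases j <;> simp [sub, ext, vertexIndex] <;> linarith)

lemma sub_cornerCell {a : Fin 3 → ℝ} {k : Fin 3} (h : ∀ j, j ≠ k → 0 < a j) (hk : 0 ≤ a k) :
    (∀ j, j ≠ k → 0 < sub a (cornerCell k) j) ∧ 0 ≤ sub a (cornerCell k) k := by
  have h0 := h 0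
  have h1 := h 1
  have h2 := h 2
  refine ⟨fun j hj => ?_, ?_⟩
  · fin_cases k <;> simp at h0 h1 h2 hk <;> fin_cases j <;> first
      | exact absurd rfl hj
      | (simp [sub, ext, vertexIndex, cornerCell]; linarith)
  · fin_cases k <;> simpa [sub, ext, vertexIndex, cornerCell] using hk

lemma harm_pos_of_pos (hq : AffineIndependent ℝ q) {a : Fin 3 → ℝ} (h : ∀ j, 0 < a j) {x : Plane}
    (hx : x ∈ gasket q) : 0 < harm hq a x := by
  obtain ⟨i, hi⟩ := Finite.exists_min a
  exact (h i).trans_le (le_harm hq hi hx)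

/-- The strong maximum principle, for boundary values with at most one zero. -/
lemma harm_pos (hq : AffineIndependent ℝ q) {a : Fin 3 → ℝ} {k : Fin 3} (h : ∀ j, j ≠ k → 0 < a j)
    (hk : 0 ≤ a k) {x : Plane} (hx : x ∈ gasket q) (hxk : x ≠ q k) : 0 < harm hq a x := by
  by_contra hn
  -- A point without positive value must lie in the corner cell at `q k` on every level, so it is `q
  -- k`.
  have key : ∀ (n : ℕ) (a : Fin 3 → ℝ) (x : Plane), (∀ j, j ≠ k → 0 < a j) → 0 ≤ a k →
      x ∈ gasket q → ¬ 0 < harm hq a x →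
      dist x (q k) ≤ (1 / 3) ^ n * Metric.diam (gasket q) := by
    intro n
    induction n with
    | zero =>
      intro a x _ _ hx _
      simpa using Metric.dist_le_diam_of_mem (gasket_compact q).isBounded hx (corner_mem k)
    | succ n ih =>
      intro a x h hk hx hn
      obtain ⟨i, y, hy, rfl⟩ := exists_F_eq hx
      rw [harm_F hq a i hy] at hn
      by_cases hi : i = cornerCell k
      · subst hi
        obtain ⟨h1, h2⟩ := sub_cornerCell h hk
        have h3 := ih _ y h1 h2 hy hn
        conv_lhs => rw [← F_cornerCell q k, F_dist]
        rw [pow_succ]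
        linarith
      · exact absurd (harm_pos_of_pos hq (sub_pos_of_ne h hk hi) hy) hn
  have h2 : Tendsto (fun n : ℕ => (1 / 3 : ℝ) ^ n * Metric.diam (gasket q)) atTop (𝓝 0) := by
    simpa using (tendsto_pow_atTop_nhds_zero_of_lt_one (r := (1 / 3 : ℝ)) (by norm_num)
      (by norm_num)).mul_const (Metric.diam (gasket q))
  exact hxk (dist_le_zero.1 (ge_of_tendsto' h2 fun n => key n a x h hk hx hn))

lemma ha_F_one_pos (hq : AffineIndependent ℝ q) {x : Plane} (hx : x ∈ gasket q) :
    0 < ha q (F q 1 x) := by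
  rw [ha_F_one hq hx]
  refine harm_pos_of_pos hq (fun j => ?_) hx
  fin_cases j <;> norm_num

lemma ha_F_two_neg (hq : AffineIndependent ℝ q) {x : Plane} (hx : x ∈ gasket q) :
    ha q (F q 2 x) < 0 := by
  rw [ha_F_two hq hx, neg_lt_zero]
  refine harm_pos_of_pos hq (fun j => ?_) hx
  fin_cases j <;> norm_num

lemma ha_F_five_nonneg (hq : AffineIndependent ℝ q) {x : Plane} (hx : x ∈ gasket q) :
    0 ≤ ha q (F q 5 x) := by
  rw [ha_F_five hq hx]
  refine le_harm hq (fun j => ?_) hx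
  fin_cases j <;> norm_num

lemma ha_F_five_le (hq : AffineIndependent ℝ q) {x : Plane} (hx : x ∈ gasket q) :
    ha q (F q 5 x) ≤ 1 / 3 := by
  rw [ha_F_five hq hx]
  refine harm_le hq (fun j => ?_) hx
  fin_cases j <;> norm_num

lemma ha_F_five_pos (hq : AffineIndependent ℝ q) {x : Plane} (hx : x ∈ gasket q) (h : x ≠ q 2) :
    0 < ha q (F q 5 x) := by
  rw [ha_F_five hq hx]
  refine harm_pos hq (k := 2) (fun j hj => ?_) (by simp) hx h
  fin_cases j
  · norm_num
  · norm_num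
  · exact absurd rfl hj

lemma ha_F_four_nonpos (hq : AffineIndependent ℝ q) {x : Plane} (hx : x ∈ gasket q) :
    ha q (F q 4 x) ≤ 0 := by
  rw [ha_F_four hq hx, neg_nonpos]
  refine le_harm hq (fun j => ?_) hx
  fin_cases j <;> norm_num

lemma ha_F_four_neg (hq : AffineIndependent ℝ q) {x : Plane} (hx : x ∈ gasket q) (h : x ≠ q 1) :
    ha q (F q 4 x) < 0 := by
  rw [ha_F_four hq hx, neg_lt_zero]
  refine harm_pos hq (k := 1) (fun j hj => ?_) (by simp) hx h
  fin_cases j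
  · norm_num
  · exact absurd rfl hj
  · norm_num

lemma F_four_one (q : Fin 3 → Plane) : F q 4 (q 1) = F q 3 (q 0) := by
  rw [F_eq_vertex, F_eq_vertex]
  rfl

lemma F_five_two (q : Fin 3 → Plane) : F q 5 (q 2) = F q 3 (q 0) := by
  rw [F_eq_vertex, F_eq_vertex]
  rfl

/-! ### The half domain and its boundary -/

lemma X_subset : X q ⊆ gasket q := fun _ hx => hx.1

lemma corner_mem_X (hq : AffineIndependent ℝ q) : q 0 ∈ X q := ⟨corner_mem 0, ha_corner hq 0⟩

lemma F_mem_X (hq : AffineIndependent ℝ q) {i : Fin 6} (hi : i = 0 ∨ i = 3) {x : Plane}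
    (hx : x ∈ X q) : F q i x ∈ X q :=
  ⟨F_mem i hx.1, by rw [ha_F_axis hq hi hx.1, hx.2, mul_zero]⟩

lemma pv_mem_X (hq : AffineIndependent ℝ q) : pv q ∈ X q := F_mem_X hq (.inr rfl) (corner_mem_X hq)

lemma mem_X_of_F (hq : AffineIndependent ℝ q) {i : Fin 6} (hi : i = 0 ∨ i = 3) {x : Plane}
    (hx : x ∈ gasket q) (h : ha q (F q i x) = 0) : x ∈ X q := by
  rw [ha_F_axis hq hi hx] at h
  exact ⟨hx, (mul_eq_zero.1 h).resolve_left (haRatio_pos i).ne'⟩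

/-- The cells 4 and 5 meet the zero set only at `p_∅`, which also lies in cell 3. -/
lemma exists_F_eq_of_mem_X (hq : AffineIndependent ℝ q) {x : Plane} (hx : x ∈ X q) :
    ∃ i, (i = 0 ∨ i = 3) ∧ ∃ y ∈ X q, F q i y = x := by
  obtain ⟨i, y, hy, rfl⟩ := exists_F_eq hx.1
  have h := hx.2
  fin_cases i
  · exact ⟨0, .inl rfl, y, mem_X_of_F hq (.inl rfl) hy h, rfl⟩
  · exact absurd h (ha_F_one_pos hq hy).ne'
  · exact absurd h (ha_F_two_neg hq hy).ne
  · exact ⟨3, .inr rfl, y, mem_X_of_F hq (.inr rfl) hy h, rfl⟩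
  · refine ⟨3, .inr rfl, q 0, corner_mem_X hq, ?_⟩
    by_cases h1 : y = q 1
    · rw [h1]
      exact (F_four_one q).symm
    · exact absurd h (ha_F_four_neg hq hy h1).ne
  · refine ⟨3, .inr rfl, q 0, corner_mem_X hq, ?_⟩
    by_cases h1 : y = q 2
    · rw [h1]
      exact (F_five_two q).symm
    · exact absurd h (ha_F_five_pos hq hy h1).ne'

lemma exists_Fw_eq_of_mem_X (hq : AffineIndependent ℝ q) (n : ℕ) {x : Plane} (hx : x ∈ X q) :
    ∃ w : List (Fin 6), w.length = n ∧ (∀ i ∈ w, i = 0 ∨ i = 3) ∧ ∃ y ∈ X q, Fw q w y = x := by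
  induction n generalizing x with
  | zero => exact ⟨[], rfl, by simp, x, hx, rfl⟩
  | succ n ih =>
    obtain ⟨i, hi, y, hy, rfl⟩ := exists_F_eq_of_mem_X hq hx
    obtain ⟨w, hw, hw', z, hz, rfl⟩ := ih hy
    refine ⟨i :: w, by simp [hw], fun j hj => ?_, z, hz, rfl⟩
    rcases List.mem_cons.1 hj with rfl | hj
    exacts [hi, hw' j hj]

lemma isClosed_ha_le (hq : AffineIndependent ℝ q) : IsClosed {x ∈ gasket q | ha q x ≤ 0} :=
  (ha_continuousOn hq).preimage_isClosed_of_isClosed (gasket_closed q) isClosed_Iic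

lemma isClosed_le_ha (hq : AffineIndependent ℝ q) : IsClosed {x ∈ gasket q | 0 ≤ ha q x} :=
  (ha_continuousOn hq).preimage_isClosed_of_isClosed (gasket_closed q) isClosed_Ici

lemma isClosed_X (hq : AffineIndependent ℝ q) : IsClosed (X q) :=
  (ha_continuousOn hq).preimage_isClosed_of_isClosed (gasket_closed q) isClosed_singleton

lemma isCompact_X (hq : AffineIndependent ℝ q) : IsCompact (X q) :=
  (gasket_compact q).of_isClosed_subset (isClosed_X hq) X_subset

lemma mem_Ω_iff (hq : AffineIndependent ℝ q) {x : Plane} :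
    x ∈ Ω q ↔ x ∈ gasket q ∧ 0 < ha q x ∧ x ≠ q 1 := by
  constructor
  · rintro ⟨⟨h1, h2⟩, h3⟩
    exact ⟨h1, h3, fun h => h2 (h ▸ mem_range_self 1)⟩
  · rintro ⟨h1, h2, h3⟩
    refine ⟨⟨h1, ?_⟩, h2⟩
    rintro ⟨k, rfl⟩
    rw [ha_corner hq] at h2
    fin_cases k
    · simp at h2
    · exact h3 rfl
    · norm_num at h2

lemma corner_notMem_Ω (a : Fin 3) : q a ∉ Ω q := fun h => h.1.2 (mem_range_self a)

lemma mem_Ω_of_ha_lt (hq : AffineIndependent ℝ q) {x : Plane} (hx : x ∈ gasket q)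
    (h0 : 0 < ha q x) (h1 : ha q x < 1) : x ∈ Ω q := by
  refine (mem_Ω_iff hq).2 ⟨hx, h0, ?_⟩
  rintro rfl
  rw [ha_corner hq] at h1
  norm_num at h1

lemma F_axis_mem_Ω (hq : AffineIndependent ℝ q) {i : Fin 6} (hi : i = 0 ∨ i = 3) {x : Plane}
    (hx : x ∈ gasket q) (h : 0 < ha q x) : F q i x ∈ Ω q := by
  have h1 := haRatio_pos i
  have h2 := haRatio_le i
  have h3 := ha_le_one hq hx
  refine mem_Ω_of_ha_lt hq (F_mem i hx) ?_ ?_ <;> rw [ha_F_axis hq hi hx]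
  · positivity
  · nlinarith

lemma F_one_mem_Ω (hq : AffineIndependent ℝ q) {x : Plane} (hx : x ∈ gasket q) (h : x ≠ q 1) :
    F q 1 x ∈ Ω q := by
  refine (mem_Ω_iff hq).2 ⟨F_mem 1 hx, ha_F_one_pos hq hx, fun h1 => h ?_⟩
  rw [← (F_corner_self q).2.1] at h1
  exact F_injective q 1 h1

lemma F_five_mem_Ω (hq : AffineIndependent ℝ q) {x : Plane} (hx : x ∈ gasket q) (h : x ≠ q 2) :
    F q 5 x ∈ Ω q :=
  mem_Ω_of_ha_lt hq (F_mem 5 hx) (ha_F_five_pos hq hx h)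
    ((ha_F_five_le hq hx).trans_lt (by norm_num))

lemma corner_ne (hq : AffineIndependent ℝ q) {i j : Fin 3} (h : i ≠ j) : q i ≠ q j :=
  fun e => h (hq.injective e)

lemma Fw_axis_mem_Ω (hq : AffineIndependent ℝ q) {w : List (Fin 6)} (hw : ∀ i ∈ w, i = 0 ∨ i = 3)
    {x : Plane} (hx : x ∈ Ω q) : Fw q w x ∈ Ω q := by
  induction w with
  | nil => exact hx
  | cons i w ih =>
    have h1 := ih fun j hj => hw j (List.mem_cons_of_mem _ hj)
    exact F_axis_mem_Ω hq (hw i List.mem_cons_self) h1.1.1 h1.2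

/-- Points of `X` lie in arbitrarily small axis cells, each containing a copy of `Ω`; `q 1` is
reached through the cells at that corner. -/
lemma closure_Ω (hq : AffineIndependent ℝ q) : closure (Ω q) = {x ∈ gasket q | 0 ≤ ha q x} := by
  refine Subset.antisymm
    (closure_minimal (fun x hx => ⟨hx.1.1, hx.2.le⟩) (isClosed_le_ha hq)) ?_
  rintro x ⟨hx, hx0⟩
  have hy : F q 1 (q 0) ∈ Ω q := F_one_mem_Ω hq (corner_mem 0) (corner_ne hq (by decide))
  rcases hx0.eq_or_lt with h0 | h0
  · refine Metric.mem_closure_iff.2 fun ε hε => ?_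
    obtain ⟨m, hm⟩ := exists_cell_small q hε
    obtain ⟨w, hw, hw', y, hyX, rfl⟩ := exists_Fw_eq_of_mem_X hq m ⟨hx, h0.symm⟩
    exact ⟨_, Fw_axis_mem_Ω hq hw' hy, hm w hw.ge _ hyX.1 _ hy.1.1⟩
  · by_cases h1 : x = q 1
    · subst h1
      refine Metric.mem_closure_iff.2 fun ε hε => ?_
      obtain ⟨m, hm⟩ := exists_cell_small q hε
      have h2 : ∀ n, Fw q (List.replicate n 1) (q 1) = q 1 ∧
          Fw q (List.replicate n 1) (F q 1 (q 0)) ∈ Ω q := by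
        intro n
        induction n with
        | zero => exact ⟨rfl, hy⟩
        | succ n ih =>
          refine ⟨?_, ?_⟩
          · simp only [List.replicate_succ, Fw, Function.comp_apply, ih.1]
            exact (F_corner_self q).2.1
          · exact F_one_mem_Ω hq ih.2.1.1 fun h => ih.2.1.2 (h ▸ mem_range_self 1)
      refine ⟨_, (h2 m).2, ?_⟩
      have h3 := hm (List.replicate m 1) (by simp) _ (corner_mem 1) _ hy.1.1
      rwa [(h2 m).1] at h3
    · exact subset_closure ((mem_Ω_iff hq).2 ⟨hx, h0, h1⟩)

lemma closure_Ω_subset (hq : AffineIndependent ℝ q) : closure (Ω q) ⊆ gasket q := by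
  rw [closure_Ω hq]
  exact fun x hx => hx.1

lemma bdry_subset (hq : AffineIndependent ℝ q) : bdry q ⊆ closure (Ω q) := by
  rw [closure_Ω hq]
  rintro x (rfl | hx)
  · exact ⟨corner_mem 1, by rw [ha_corner hq]; norm_num⟩
  · exact ⟨hx.1, hx.2.ge⟩

lemma F_mem_closure_Ω (hq : AffineIndependent ℝ q) {i : Fin 6} (hi : i = 0 ∨ i = 3) {x : Plane}
    (hx : x ∈ closure (Ω q)) : F q i x ∈ closure (Ω q) := by
  rw [closure_Ω hq] at hx ⊢
  refine ⟨F_mem i hx.1, ?_⟩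
  rw [ha_F_axis hq hi hx.1]
  exact mul_nonneg (haRatio_pos i).le hx.2

lemma F_one_mem_closure_Ω (hq : AffineIndependent ℝ q) {x : Plane} (hx : x ∈ gasket q) :
    F q 1 x ∈ closure (Ω q) := by
  rw [closure_Ω hq]
  exact ⟨F_mem 1 hx, (ha_F_one_pos hq hx).le⟩

lemma F_five_mem_closure_Ω (hq : AffineIndependent ℝ q) {x : Plane} (hx : x ∈ gasket q) :
    F q 5 x ∈ closure (Ω q) := by
  rw [closure_Ω hq]
  exact ⟨F_mem 5 hx, ha_F_five_nonneg hq hx⟩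

lemma Fw_mem_closure_Ω (hq : AffineIndependent ℝ q) {w : List (Fin 6)}
    (hw : ∀ i ∈ w, i = 0 ∨ i = 3) {x : Plane} (hx : x ∈ closure (Ω q)) :
    Fw q w x ∈ closure (Ω q) := by
  induction w with
  | nil => exact hx
  | cons i w ih =>
    exact F_mem_closure_Ω hq (hw i List.mem_cons_self)
      (ih fun j hj => hw j (List.mem_cons_of_mem _ hj))

/-- Entering an axis cell shrinks `ha` by at least the factor `4/15`, so a point with `ha > 0`
leaves the axis cells after finitely many letters. -/
lemma exists_axis_word (hq : AffineIndependent ℝ q) {x : Plane} (hx : x ∈ gasket q)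
    (h : 0 < ha q x) : ∃ w : List (Fin 6), (∀ i ∈ w, i = 0 ∨ i = 3) ∧
      x ∈ Fw q w '' (F q 1 '' gasket q ∪ F q 5 '' gasket q) := by
  have key : ∀ (n : ℕ) (x : Plane), x ∈ gasket q → (4 / 15 : ℝ) ^ n < ha q x →
      ∃ w : List (Fin 6), (∀ i ∈ w, i = 0 ∨ i = 3) ∧
        x ∈ Fw q w '' (F q 1 '' gasket q ∪ F q 5 '' gasket q) := by
    intro n
    induction n with
    | zero =>
      intro x hx h
      exact absurd (ha_le_one hq hx) (by simpa using h)
    | succ n ih =>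
      intro x hx h
      obtain ⟨i, y, hy, rfl⟩ := exists_F_eq hx
      have hp : (0 : ℝ) < (4 / 15) ^ (n + 1) := by positivity
      have haxis : (i = 0 ∨ i = 3) → ∃ w : List (Fin 6), (∀ i ∈ w, i = 0 ∨ i = 3) ∧
          F q i y ∈ Fw q w '' (F q 1 '' gasket q ∪ F q 5 '' gasket q) := by
        intro hi
        rw [ha_F_axis hq hi hy] at h
        have h1 := haRatio_pos i
        have h2 := haRatio_le i
        have h3 : 0 < ha q y := by
          by_contra h3
          nlinarith
        obtain ⟨w, hw, z, hz, rfl⟩ := ih y hy (by rw [pow_succ] at h; nlinarith)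
        refine ⟨i :: w, fun j hj => ?_, z, hz, rfl⟩
        rcases List.mem_cons.1 hj with rfl | hj
        exacts [hi, hw j hj]
      fin_cases i
      · exact haxis (.inl rfl)
      · exact ⟨[], by simp, _, .inl ⟨y, hy, rfl⟩, rfl⟩
      · exact absurd (ha_F_two_neg hq hy) (not_lt.2 (hp.trans h).le)
      · exact haxis (.inr rfl)
      · exact absurd (ha_F_four_nonpos hq hy) (not_le.2 (hp.trans h))
      · exact ⟨[], by simp, _, .inr ⟨y, hy, rfl⟩, rfl⟩
  obtain ⟨n, hn⟩ := exists_pow_lt_of_lt_one h (show (4 / 15 : ℝ) < 1 by norm_num)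
  exact key n x hx hn

lemma closure_Ω_eq_closure_iUnion (hq : AffineIndependent ℝ q) :
    closure (Ω q) = closure (⋃ w : HalfWord,
      Fw q w.1 '' (F q 1 '' gasket q ∪ F q 5 '' gasket q)) := by
  refine Subset.antisymm (closure_mono fun x hx => ?_) (closure_minimal ?_ isClosed_closure)
  · obtain ⟨w, hw, h⟩ := exists_axis_word hq hx.1.1 hx.2
    exact mem_iUnion.2 ⟨⟨w, hw⟩, h⟩
  · refine iUnion_subset fun w => ?_
    rintro _ ⟨_, ⟨x, hx, rfl⟩ | ⟨x, hx, rfl⟩, rfl⟩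
    · exact Fw_mem_closure_Ω hq w.2 (F_one_mem_closure_Ω hq hx)
    · exact Fw_mem_closure_Ω hq w.2 (F_five_mem_closure_Ω hq hx)

/-! ### Integration with respect to the measure `μ` -/

/-- The mass of `μ` at the point `F_w p_∅`. -/
def mass (w : HalfWord) : ℝ := 2 / 7 * weight w

/-- The integral over `X` with respect to `μ`. -/
def integralX (q : Fin 3 → Plane) (f : Plane → ℝ) : ℝ := ∫ s in X q, f s ∂(μ q)

lemma weight_nonneg (w : HalfWord) : 0 ≤ weight w := by
  refine List.prod_nonneg fun x hx => ?_
  obtain ⟨i, _, rfl⟩ := List.mem_map.1 hx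
  split_ifs <;> norm_num

lemma mass_nonneg (w : HalfWord) : 0 ≤ mass w := mul_nonneg (by norm_num) (weight_nonneg w)

/-- The words of length `n` contribute the `n`-th power of the sum over letters: a geometric series.
-/
lemma summable_prod_letters {α : Type*} [Fintype α] (g : α → ℝ) (h0 : ∀ a, 0 ≤ g a)
    (h1 : ∑ a, g a < 1) : Summable fun l : List α => (l.map g).prod := by
  rw [← List.equivSigmaTuple.symm.summable_iff, summable_sigma_of_nonneg]
  · have h2 : ∀ n : ℕ, ∑' p : Fin n → α, (((List.ofFn p).map g).prod) = (∑ a, g a) ^ n := fun n => by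
      rw [tsum_fintype, Fintype.sum_pow]
      refine Finset.sum_congr rfl fun p _ => ?_
      rw [List.map_ofFn, List.prod_ofFn]
      rfl
    refine ⟨fun n => (hasSum_fintype _).summable, ?_⟩
    refine (summable_geometric_of_lt_one (Finset.sum_nonneg fun a _ => h0 a) h1).congr fun n => ?_
    exact (h2 n).symm
  · intro p
    refine List.prod_nonneg fun x hx => ?_
    obtain ⟨i, _, rfl⟩ := List.mem_map.1 hx
    exact h0 i

lemma summable_mass : Summable mass := by
  -- The other four letters get weight zero; the ratio is `5/7`.
  have h := summable_prod_letters (α := Fin 6) ![1 / 7, 0, 0, 4 / 7, 0, 0]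
    (fun a => by fin_cases a <;> norm_num)
    (by simp [Fin.sum_univ_six]; norm_num)
  refine ((h.comp_injective (Subtype.val_injective (p := fun w : List (Fin 6) =>
    ∀ i ∈ w, i = 0 ∨ i = 3))).mul_left (2 / 7)).congr fun w => ?_
  simp only [mass, weight, Function.comp_apply]
  congr 2
  refine List.map_congr_left fun i hi => ?_
  rcases w.2 i hi with rfl | rfl <;> simp

/-- The empty word. -/
def HalfWord.nil : HalfWord := ⟨[], by simp⟩

/-- Prepending a letter to a word. -/
def HalfWord.cons (i : Fin 6) (hi : i = 0 ∨ i = 3) (w : HalfWord) : HalfWord :=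
  ⟨i :: w.1, List.forall_mem_cons.2 ⟨hi, w.2⟩⟩

/-- A word is empty or starts with `0` or with `3`. -/
def HalfWord.split : Unit ⊕ (HalfWord ⊕ HalfWord) → HalfWord :=
  Sum.elim (fun _ => .nil) (Sum.elim (.cons 0 (.inl rfl)) (.cons 3 (.inr rfl)))

lemma HalfWord.split_bijective : Function.Bijective HalfWord.split := by
  constructor
  · rintro (_ | w | w) (_ | v | v) h <;>
      simp [HalfWord.split, HalfWord.nil, HalfWord.cons, Subtype.ext_iff] at h ⊢ <;> exact h
  · rintro ⟨_ | ⟨i, w⟩, hw⟩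
    · exact ⟨.inl (), rfl⟩
    · have hw' : ∀ i ∈ w, i = 0 ∨ i = 3 := fun j hj => hw j (List.mem_cons_of_mem _ hj)
      obtain rfl | rfl := hw i List.mem_cons_self
      · exact ⟨.inr (.inl ⟨w, hw'⟩), rfl⟩
      · exact ⟨.inr (.inr ⟨w, hw'⟩), rfl⟩

lemma tsum_halfWord {g : HalfWord → ℝ} (hg : Summable g) :
    ∑' w, g w = g .nil + (∑' w, g (.cons 0 (.inl rfl) w) + ∑' w, g (.cons 3 (.inr rfl) w)) := by
  have hb := hg.comp_injective HalfWord.split_bijective.1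
  have h1 : Summable ((g ∘ HalfWord.split) ∘ Sum.inr) := hb.comp_injective Sum.inr_injective
  rw [← (Equiv.ofBijective _ HalfWord.split_bijective).tsum_eq g]
  change ∑' x, (g ∘ HalfWord.split) x = _
  rw [Summable.tsum_sum (f := g ∘ HalfWord.split) (hb.comp_injective Sum.inl_injective) h1]
  congr 1
  · rw [tsum_fintype]
    simp [HalfWord.split]
  · exact Summable.tsum_sum (f := (g ∘ HalfWord.split) ∘ Sum.inr) (h1.comp_injective Sum.inl_injective)
      (h1.comp_injective Sum.inr_injective)

lemma mass_nil : mass .nil = 2 / 7 := by simp [mass, weight, HalfWord.nil]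

lemma mass_zero (w : HalfWord) : mass (.cons 0 (.inl rfl) w) = 1 / 7 * mass w := by
  simp [mass, weight, HalfWord.cons]
  ring

lemma mass_three (w : HalfWord) : mass (.cons 3 (.inr rfl) w) = 4 / 7 * mass w := by
  simp [mass, weight, HalfWord.cons]
  ring

/-- Splitting off the first letter, the total mass `S` satisfies `S = 2/7 + (5/7) S`. -/
lemma tsum_mass : ∑' w, mass w = 1 := by
  have h := tsum_halfWord summable_mass
  simp only [mass_nil, mass_zero, mass_three, tsum_mul_left] at h
  linarith

lemma Fw_mem_X (hq : AffineIndependent ℝ q) {w : List (Fin 6)} (hw : ∀ i ∈ w, i = 0 ∨ i = 3)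
    {x : Plane} (hx : x ∈ X q) : Fw q w x ∈ X q := by
  induction w with
  | nil => exact hx
  | cons i w ih =>
    exact F_mem_X hq (hw i List.mem_cons_self) (ih fun j hj => hw j (List.mem_cons_of_mem _ hj))

lemma Fw_pv_mem_X (hq : AffineIndependent ℝ q) (w : HalfWord) : Fw q w.1 (pv q) ∈ X q :=
  Fw_mem_X hq w.2 (pv_mem_X hq)

lemma integralX_eq (hq : AffineIndependent ℝ q) (f : Plane → ℝ) :
    integralX q f = ∑' w : HalfWord, mass w * f (Fw q w.1 (pv q)) := by
  rw [integralX, ← integral_indicator (isClosed_X hq).measurableSet, μ,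
    integral_sum_dirac fun _ => ENNReal.ofReal_ne_top]
  refine tsum_congr fun w => ?_
  change (ENNReal.ofReal (mass w)).toReal • _ = _
  rw [ENNReal.toReal_ofReal (mass_nonneg w), indicator_of_mem (Fw_pv_mem_X hq w), smul_eq_mul]

lemma integralX_congr (hq : AffineIndependent ℝ q) {f g : Plane → ℝ} (h : EqOn f g (X q)) :
    integralX q f = integralX q g := by
  simp only [integralX_eq hq]
  exact tsum_congr fun w => by rw [h (Fw_pv_mem_X hq w)]

lemma summable_mass_mul (hq : AffineIndependent ℝ q) {f : Plane → ℝ} (hf : ContinuousOn f (X q)) :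
    Summable fun w : HalfWord => mass w * f (Fw q w.1 (pv q)) := by
  obtain ⟨C, hC⟩ := (isCompact_X hq).exists_bound_of_continuousOn hf
  refine Summable.of_norm_bounded (summable_mass.mul_right C) fun w => ?_
  rw [norm_mul, Real.norm_of_nonneg (mass_nonneg w)]
  exact mul_le_mul_of_nonneg_left (hC _ (Fw_pv_mem_X hq w)) (mass_nonneg w)

lemma continuousOn_comp_F (hq : AffineIndependent ℝ q) {f : Plane → ℝ} (hf : ContinuousOn f (X q))
    {i : Fin 6} (hi : i = 0 ∨ i = 3) : ContinuousOn (f ∘ F q i) (X q) :=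
  hf.comp (F_continuous q i).continuousOn fun _ hx => F_mem_X hq hi hx

/-- The self-similarity of `μ`. -/
lemma integralX_split (hq : AffineIndependent ℝ q) {f : Plane → ℝ} (hf : ContinuousOn f (X q)) :
    integralX q f = 2 / 7 * f (pv q) + 1 / 7 * integralX q (f ∘ F q 0) +
      4 / 7 * integralX q (f ∘ F q 3) := by
  simp only [integralX_eq hq]
  rw [tsum_halfWord (summable_mass_mul hq hf)]
  simp only [mass_nil, mass_zero, mass_three, mul_assoc, tsum_mul_left]
  rw [← add_assoc]
  rfl

lemma integralX_const (hq : AffineIndependent ℝ q) (c : ℝ) : integralX q (fun _ => c) = c := by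
  rw [integralX_eq hq, tsum_mul_right, tsum_mass, one_mul]

lemma integralX_le (hq : AffineIndependent ℝ q) {f g : Plane → ℝ} (hf : ContinuousOn f (X q))
    (hg : ContinuousOn g (X q)) {B : ℝ} (h : ∀ x ∈ X q, f x ≤ g x + B) :
    integralX q f ≤ integralX q g + B := by
  have hB : ∑' w, mass w * B = B := by rw [tsum_mul_right, tsum_mass, one_mul]
  rw [integralX_eq hq, integralX_eq hq]
  conv_rhs => rw [← hB, ← (summable_mass_mul hq hg).tsum_add (summable_mass.mul_right B)]
  refine (summable_mass_mul hq hf).tsum_le_tsum (fun w => ?_)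
    ((summable_mass_mul hq hg).add (summable_mass.mul_right B))
  rw [← mul_add]
  exact mul_le_mul_of_nonneg_left (h _ (Fw_pv_mem_X hq w)) (mass_nonneg w)

/-! ### Construction of the solution -/

/-- The value at `x_∅` of the solution with value `c` at `q 1` and values `f` on `X`. -/
def xval (q : Fin 3 → Plane) (c : ℝ) (f : Plane → ℝ) : ℝ :=
  4 / 15 * c + 1 / 15 * f (pv q) + 1 / 30 * integralX q (f ∘ F q 0) +
    19 / 30 * integralX q (f ∘ F q 3)

/-- The value at `y_∅` of the solution with value `c` at `q 1` and values `f` on `X`. -/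
def yval (q : Fin 3 → Plane) (c : ℝ) (f : Plane → ℝ) : ℝ :=
  1 / 3 * c + 1 / 3 * f (pv q) + 1 / 6 * integralX q (f ∘ F q 0) + 1 / 6 * integralX q (f ∘ F q 3)

/-- The value at `z_∅` of the solution with value `c` at `q 1` and values `f` on `X`. -/
def zval (q : Fin 3 → Plane) (c : ℝ) (f : Plane → ℝ) : ℝ :=
  1 / 15 * c + 4 / 15 * f (pv q) + 19 / 30 * integralX q (f ∘ F q 0) +
    1 / 30 * integralX q (f ∘ F q 3)

/-- The restrictions of the solution to the cells of the first level, where `U c f` is the solution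
with values `c` at `q 1` and `f` on `X`, extended by reflection in the axis. -/
def pieces (hq : AffineIndependent ℝ q) (U : ℝ → (Plane → ℝ) → Plane → ℝ) (c : ℝ)
    (f : Plane → ℝ) : Fin 6 → Plane → ℝ :=
  ![U (zval q c f) (f ∘ F q 0), harm hq ![yval q c f, c, xval q c f],
    harm hq ![yval q c f, xval q c f, c], U (xval q c f) (f ∘ F q 3),
    harm hq ![zval q c f, f (pv q), yval q c f], harm hq ![zval q c f, yval q c f, f (pv q)]]

/-- The values of the reflected solution at the ten vertices of the first level. -/
def vertexVal (q : Fin 3 → Plane) (c : ℝ) (f : Plane → ℝ) : Fin 10 → ℝ :=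
  ![f (q 0), c, c, f (pv q), zval q c f, yval q c f, xval q c f, xval q c f, yval q c f, zval q c f]

lemma pieces_corner (hq : AffineIndependent ℝ q) {U : ℝ → (Plane → ℝ) → Plane → ℝ}
    (hU : ∀ c f k, U c f (q k) = ![f (q 0), c, c] k) (c : ℝ) (f : Plane → ℝ) (i : Fin 6)
    (a : Fin 3) : pieces hq U c f i (q a) = vertexVal q c f (vertexIndex i a) := by
  have h0 := (F_corner_self q).1
  fin_cases i <;> fin_cases a <;>
    simp [pieces, hU, harm_corner, vertexVal, vertexIndex, h0, pv]

/-- Approximations of the solution: exact for boundary values that are constant on the pieces of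
`X` of level `n`. -/
def solApprox (hq : AffineIndependent ℝ q) : ℕ → ℝ → (Plane → ℝ) → Plane → ℝ
  | 0, c, f => fun x => f (q 0) + (c - f (q 0)) * |ha q x|
  | n + 1, c, f => glue q (pieces hq (solApprox hq n) c f)

lemma solApprox_corner (hq : AffineIndependent ℝ q) (n : ℕ) (c : ℝ) (f : Plane → ℝ) (k : Fin 3) :
    solApprox hq n c f (q k) = ![f (q 0), c, c] k := by
  induction n generalizing c f k with
  | zero =>
    simp only [solApprox, ha_corner hq]
    fin_cases k <;> simp
  | succ n ih =>
    obtain ⟨h0, h1, h2⟩ := glue_corner hq (vertexVal q c f) (pieces_corner hq ih c f)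
    fin_cases k
    exacts [h0, h1, h2]

lemma solApprox_F (hq : AffineIndependent ℝ q) (n : ℕ) (c : ℝ) (f : Plane → ℝ) (i : Fin 6)
    {x : Plane} (hx : x ∈ gasket q) :
    solApprox hq (n + 1) c f (F q i x) = pieces hq (solApprox hq n) c f i x :=
  glue_F hq (vertexVal q c f) (pieces_corner hq (solApprox_corner hq n) c f) i hx

lemma solApprox_continuousOn (hq : AffineIndependent ℝ q) (n : ℕ) (c : ℝ) (f : Plane → ℝ) :
    ContinuousOn (solApprox hq n c f) (gasket q) := by
  induction n generalizing c f with
  | zero => exact continuousOn_const.add (continuousOn_const.mul (ha_continuousOn hq).abs)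
  | succ n ih =>
    refine glue_continuousOn hq (vertexVal q c f)
      (pieces_corner hq (solApprox_corner hq n) c f) fun i => ?_
    fin_cases i
    exacts [ih _ _, harm_continuousOn hq _, harm_continuousOn hq _, ih _ _, harm_continuousOn hq _,
      harm_continuousOn hq _]

lemma harm_le_add (hq : AffineIndependent ℝ q) {a b : Fin 3 → ℝ} {B : ℝ} (h : ∀ k, a k ≤ b k + B)
    {x : Plane} (hx : x ∈ gasket q) : harm hq a x ≤ harm hq b x + B := by
  have h1 := harm_linear hq 1 (-1) a b hx
  have h2 := harm_le hq (a := (1 : ℝ) • a + (-1 : ℝ) • b) (l := B) (fun k => by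
    have := h k
    simp only [Pi.add_apply, Pi.smul_apply, smul_eq_mul]
    linarith) hx
  linarith

/-- In each of the three formulas the coefficients are nonnegative with sum one, and `μ` has mass
one. -/
lemma vertexVal_le (hq : AffineIndependent ℝ q) {c c' B : ℝ} {f g : Plane → ℝ}
    (hf : ContinuousOn f (X q)) (hg : ContinuousOn g (X q)) (hc : c ≤ c' + B)
    (h : ∀ x ∈ X q, f x ≤ g x + B) :
    f (pv q) ≤ g (pv q) + B ∧ xval q c f ≤ xval q c' g + B ∧ yval q c f ≤ yval q c' g + B ∧
      zval q c f ≤ zval q c' g + B := by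
  have hp := h _ (pv_mem_X hq)
  have h0 := integralX_le hq (continuousOn_comp_F hq hf (.inl rfl))
    (continuousOn_comp_F hq hg (.inl rfl)) fun x hx => h _ (F_mem_X hq (.inl rfl) hx)
  have h3 := integralX_le hq (continuousOn_comp_F hq hf (.inr rfl))
    (continuousOn_comp_F hq hg (.inr rfl)) fun x hx => h _ (F_mem_X hq (.inr rfl) hx)
  simp only [xval, yval, zval]
  refine ⟨hp, ?_, ?_, ?_⟩ <;> linarith

/-- The comparison principle. -/
lemma solApprox_le (hq : AffineIndependent ℝ q) (n : ℕ) {c c' B : ℝ} {f g : Plane → ℝ}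
    (hf : ContinuousOn f (X q)) (hg : ContinuousOn g (X q)) (hc : c ≤ c' + B)
    (h : ∀ x ∈ X q, f x ≤ g x + B) {x : Plane} (hx : x ∈ gasket q) :
    solApprox hq n c f x ≤ solApprox hq n c' g x + B := by
  induction n generalizing c c' f g x with
  | zero =>
    simp only [solApprox]
    have h0 := h _ (corner_mem_X hq)
    have h1 : |ha q x| ≤ 1 := abs_le.2 ⟨neg_one_le_ha hq hx, ha_le_one hq hx⟩
    have h2 := abs_nonneg (ha q x)
    -- The value is a convex combination of `c` and `f (q 0)` with weights `|ha|` and `1 - |ha|`.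
    nlinarith [mul_nonneg h2 (sub_nonneg.2 hc), mul_nonneg (sub_nonneg.2 h1) (sub_nonneg.2 h0)]
  | succ n ih =>
    obtain ⟨i, y, hy, rfl⟩ := exists_F_eq hx
    rw [solApprox_F hq _ _ _ _ hy, solApprox_F hq _ _ _ _ hy]
    obtain ⟨hp, hX, hY, hZ⟩ := vertexVal_le hq hf hg hc h
    fin_cases i
    · exact ih (continuousOn_comp_F hq hf (.inl rfl)) (continuousOn_comp_F hq hg (.inl rfl)) hZ
        (fun x hx => h _ (F_mem_X hq (.inl rfl) hx)) hy
    · exact harm_le_add hq (fun k => by fin_cases k <;> assumption) hy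
    · exact harm_le_add hq (fun k => by fin_cases k <;> assumption) hy
    · exact ih (continuousOn_comp_F hq hf (.inr rfl)) (continuousOn_comp_F hq hg (.inr rfl)) hX
        (fun x hx => h _ (F_mem_X hq (.inr rfl) hx)) hy
    · exact harm_le_add hq (fun k => by fin_cases k <;> assumption) hy
    · exact harm_le_add hq (fun k => by fin_cases k <;> assumption) hy

lemma harm_affine (hq : AffineIndependent ℝ q) {a b : Fin 3 → ℝ} {s t : ℝ}
    (h : ∀ k, a k = s + t * b k) {x : Plane} (hx : x ∈ gasket q) :
    harm hq a x = s + t * harm hq b x := by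
  have e : a = s • (fun _ => 1) + t • b := by
    funext k
    simp [h]
  rw [e, harm_linear hq _ _ _ _ hx, harm_const hq (fun _ => rfl) hx, mul_one]

/-- For constant `f` the formulas give `x, y, z` in the proportions `4/15, 1/3, 1/15` of `ha` at
these vertices, so the recursion reproduces `|ha|`. -/
lemma solApprox_const (hq : AffineIndependent ℝ q) (n : ℕ) (c b : ℝ) {x : Plane}
    (hx : x ∈ gasket q) : solApprox hq n c (fun _ => b) x = b + (c - b) * |ha q x| := by
  have e : ∀ i, (fun _ : Plane => b) ∘ F q i = fun _ => b := fun i => rfl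
  have hX : ∀ c, xval q c (fun _ => b) = b + (c - b) * (4 / 15) := fun c => by
    simp only [xval, e, integralX_const hq]
    ring
  have hY : ∀ c, yval q c (fun _ => b) = b + (c - b) * (1 / 3) := fun c => by
    simp only [yval, e, integralX_const hq]
    ring
  have hZ : ∀ c, zval q c (fun _ => b) = b + (c - b) * (1 / 15) := fun c => by
    simp only [zval, e, integralX_const hq]
    ring
  have hn : ∀ {a : Fin 3 → ℝ}, (∀ k, 0 ≤ a k) → ∀ {x}, x ∈ gasket q →
      |harm hq a x| = harm hq a x := fun h _ hx => abs_of_nonneg (le_harm hq h hx)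
  induction n generalizing c x with
  | zero => rfl
  | succ n ih =>
    obtain ⟨i, y, hy, rfl⟩ := exists_F_eq hx
    rw [solApprox_F hq _ _ _ _ hy]
    fin_cases i
    · change solApprox hq n (zval q c fun _ => b) (fun _ => b) y = b + (c - b) * |ha q (F q 0 y)|
      rw [ih _ hy, ha_F_axis hq (.inl rfl) hy, hZ, haRatio, if_pos rfl, abs_mul,
        abs_of_nonneg (by norm_num : (0 : ℝ) ≤ 1 / 15)]
      ring
    · change harm hq ![yval q c fun _ => b, c, xval q c fun _ => b] y = b + (c - b) * |ha q (F q 1 y)|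
      rw [ha_F_one hq hy, hn (fun k => by fin_cases k <;> norm_num) hy]
      refine harm_affine hq (fun k => ?_) hy
      fin_cases k <;> simp [hX, hY]
    · change harm hq ![yval q c fun _ => b, xval q c fun _ => b, c] y = b + (c - b) * |ha q (F q 2 y)|
      rw [ha_F_two hq hy, abs_neg, hn (fun k => by fin_cases k <;> norm_num) hy]
      refine harm_affine hq (fun k => ?_) hy
      fin_cases k <;> simp [hX, hY]
    · change solApprox hq n (xval q c fun _ => b) (fun _ => b) y = b + (c - b) * |ha q (F q 3 y)|
      rw [ih _ hy, ha_F_axis hq (.inr rfl) hy, hX, haRatio, if_neg (by decide), abs_mul,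
        abs_of_nonneg (by norm_num : (0 : ℝ) ≤ 4 / 15)]
      ring
    · change harm hq ![zval q c fun _ => b, b, yval q c fun _ => b] y = b + (c - b) * |ha q (F q 4 y)|
      rw [ha_F_four hq hy, abs_neg, hn (fun k => by fin_cases k <;> norm_num) hy]
      refine harm_affine hq (fun k => ?_) hy
      fin_cases k <;> simp [hZ, hY]
    · change harm hq ![zval q c fun _ => b, yval q c fun _ => b, b] y = b + (c - b) * |ha q (F q 5 y)|
      rw [ha_F_five hq hy, hn (fun k => by fin_cases k <;> norm_num) hy]
      refine harm_affine hq (fun k => ?_) hy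
      fin_cases k <;> simp [hZ, hY]

/-! ### Convergence of the approximations and boundary values of the limit. -/

/-- The oscillation of `f` on the pieces of `X` of level `n` is at most `ω`. -/
def OscLe (q : Fin 3 → Plane) (n : ℕ) (f : Plane → ℝ) (ω : ℝ) : Prop :=
  ∀ w : List (Fin 6), w.length = n → (∀ i ∈ w, i = 0 ∨ i = 3) → ∀ x ∈ X q, ∀ y ∈ X q,
    f (Fw q w x) ≤ f (Fw q w y) + ω

lemma OscLe.comp_F {n : ℕ} {f : Plane → ℝ} {ω : ℝ} (h : OscLe q (n + 1) f ω) {i : Fin 6}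
    (hi : i = 0 ∨ i = 3) : OscLe q n (f ∘ F q i) ω :=
  fun w hw hw' x hx y hy => h (i :: w) (by simp [hw]) (List.forall_mem_cons.2 ⟨hi, hw'⟩) x hx y hy

lemma OscLe.nonneg (hq : AffineIndependent ℝ q) {n : ℕ} {f : Plane → ℝ} {ω : ℝ}
    (h : OscLe q n f ω) : 0 ≤ ω := by
  have := h (List.replicate n 0) (by simp) (fun i hi => .inl (List.eq_of_mem_replicate hi)) _
    (corner_mem_X hq) _ (corner_mem_X hq)
  linarith

lemma exists_oscLe (hq : AffineIndependent ℝ q) {f : Plane → ℝ} (hf : ContinuousOn f (X q)) {ε : ℝ}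
    (hε : 0 < ε) : ∃ n, OscLe q n f ε := by
  obtain ⟨δ, hδ, hδf⟩ := Metric.uniformContinuousOn_iff.1
    ((isCompact_X hq).uniformContinuousOn_of_continuous hf) ε hε
  obtain ⟨m, hm⟩ := exists_cell_small q hδ
  refine ⟨m, fun w hw hw' x hx y hy => ?_⟩
  have h1 := hδf _ (Fw_mem_X hq hw' hx) _ (Fw_mem_X hq hw' hy) (hm w hw.ge _ hx.1 _ hy.1)
  rw [Real.dist_eq] at h1
  linarith [(abs_lt.1 h1).2]

/-- After `n` letters the data are within `ω` of a constant, for which all approximations agree; the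
comparison principle does the rest. -/
lemma solApprox_cauchy (hq : AffineIndependent ℝ q) (n k : ℕ) {c ω : ℝ} {f : Plane → ℝ}
    (hf : ContinuousOn f (X q)) (h : OscLe q n f ω) {x : Plane} (hx : x ∈ gasket q) :
    |solApprox hq (n + k) c f x - solApprox hq n c f x| ≤ ω := by
  induction n generalizing c f x with
  | zero =>
    have h0 := h.nonneg hq
    have hosc : ∀ x ∈ X q, ∀ y ∈ X q, f x ≤ f y + ω := h [] rfl (by simp)
    -- Level zero sees only `f (q 0)`, so it equals the approximation of any level for that
    -- constant.
    have e : solApprox hq 0 c f x = solApprox hq (0 + k) c (fun _ => f (q 0)) x :=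
      (solApprox_const hq _ _ _ hx).symm
    have h1 := solApprox_le hq (0 + k) (c := c) (c' := c) (B := ω) hf
      (continuousOn_const (c := f (q 0))) (by linarith)
      (fun x hx => hosc x hx _ (corner_mem_X hq)) hx
    have h2 := solApprox_le hq (0 + k) (c := c) (c' := c) (B := ω)
      (continuousOn_const (c := f (q 0))) hf (by linarith)
      (fun x hx => hosc _ (corner_mem_X hq) x hx) hx
    rw [e, abs_le]
    constructor <;> linarith
  | succ n ih =>
    obtain ⟨i, y, hy, rfl⟩ := exists_F_eq hx
    rw [show n + 1 + k = n + k + 1 by ring, solApprox_F hq _ _ _ _ hy, solApprox_F hq _ _ _ _ hy]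
    have h0 := h.nonneg hq
    -- The harmonic pieces on the cells 1, 2, 4, 5 do not depend on the level.
    have hself : ∀ r : ℝ, |r - r| ≤ ω := fun r => by simpa using h0
    fin_cases i
    exacts [ih (continuousOn_comp_F hq hf (.inl rfl)) (h.comp_F (.inl rfl)) hy, hself _, hself _,
      ih (continuousOn_comp_F hq hf (.inr rfl)) (h.comp_F (.inr rfl)) hy, hself _, hself _]

lemma solApprox_uniform (hq : AffineIndependent ℝ q) (c : ℝ) {f : Plane → ℝ}
    (hf : ContinuousOn f (X q)) : ∀ ε > 0, ∃ n, ∀ k, ∀ x ∈ gasket q,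
      |solApprox hq (n + k) c f x - solApprox hq n c f x| ≤ ε := by
  intro ε hε
  obtain ⟨n, hn⟩ := exists_oscLe hq hf hε
  exact ⟨n, fun k x hx => solApprox_cauchy hq n k hf hn hx⟩

lemma abs_solApprox_sub_le (hq : AffineIndependent ℝ q) (n : ℕ) {c ω : ℝ} {f : Plane → ℝ}
    (h : OscLe q n f ω) {x : Plane} (hx : x ∈ X q) : |solApprox hq n c f x - f x| ≤ ω := by
  induction n generalizing c f x with
  | zero =>
    have h1 := h [] rfl (by simp) x hx _ (corner_mem_X hq)
    have h2 := h [] rfl (by simp) _ (corner_mem_X hq) x hx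
    simp only [Fw, id] at h1 h2
    simp only [solApprox, hx.2, abs_zero, mul_zero, add_zero]
    rw [abs_le]
    constructor <;> linarith
  | succ n ih =>
    obtain ⟨i, hi, y, hy, rfl⟩ := exists_F_eq_of_mem_X hq hx
    rw [solApprox_F hq _ _ _ _ hy.1]
    rcases hi with rfl | rfl
    · exact ih (h.comp_F (.inl rfl)) hy
    · exact ih (h.comp_F (.inr rfl)) hy

/-- The solution with value `c` at `q 1` and values `f` on `X`, extended to the gasket by
reflection in the axis. -/
def sol (hq : AffineIndependent ℝ q) (c : ℝ) (f : Plane → ℝ) : Plane → ℝ :=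
  limFun fun n => solApprox hq n c f

lemma sol_tendsto (hq : AffineIndependent ℝ q) (c : ℝ) {f : Plane → ℝ}
    (hf : ContinuousOn f (X q)) {x : Plane} (hx : x ∈ gasket q) :
    Tendsto (fun n => solApprox hq n c f x) atTop (𝓝 (sol hq c f x)) :=
  limFun_tendsto (solApprox_uniform hq c hf) hx

lemma sol_continuousOn (hq : AffineIndependent ℝ q) (c : ℝ) {f : Plane → ℝ}
    (hf : ContinuousOn f (X q)) : ContinuousOn (sol hq c f) (gasket q) :=
  limFun_continuousOn (solApprox_uniform hq c hf) fun n => solApprox_continuousOn hq n c f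

lemma sol_corner (hq : AffineIndependent ℝ q) (c : ℝ) {f : Plane → ℝ} (hf : ContinuousOn f (X q))
    (k : Fin 3) : sol hq c f (q k) = ![f (q 0), c, c] k := by
  refine tendsto_nhds_unique (sol_tendsto hq c hf (corner_mem k)) ?_
  simp only [solApprox_corner]
  exact tendsto_const_nhds

lemma sol_F (hq : AffineIndependent ℝ q) (c : ℝ) {f : Plane → ℝ} (hf : ContinuousOn f (X q))
    (i : Fin 6) {x : Plane} (hx : x ∈ gasket q) :
    sol hq c f (F q i x) = pieces hq (sol hq) c f i x := by
  refine tendsto_nhds_unique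
    ((sol_tendsto hq c hf (F_mem i hx)).comp (tendsto_add_atTop_nat 1)) ?_
  refine Tendsto.congr (fun n => (solApprox_F hq n c f i hx).symm) ?_
  fin_cases i
  exacts [sol_tendsto hq _ (continuousOn_comp_F hq hf (.inl rfl)) hx, tendsto_const_nhds,
    tendsto_const_nhds, sol_tendsto hq _ (continuousOn_comp_F hq hf (.inr rfl)) hx,
    tendsto_const_nhds, tendsto_const_nhds]

lemma sol_eqOn_X (hq : AffineIndependent ℝ q) (c : ℝ) {f : Plane → ℝ} (hf : ContinuousOn f (X q)) :
    EqOn (sol hq c f) f (X q) := by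
  intro x hx
  refine eq_of_abs_sub_le_all fun ε hε => ?_
  obtain ⟨n, hn⟩ := exists_oscLe hq hf (half_pos hε)
  have h1 : |sol hq c f x - solApprox hq n c f x| ≤ ε / 2 :=
    abs_limFun_sub_le (g := fun n => solApprox hq n c f) (solApprox_uniform hq c hf)
      (fun k x hx => solApprox_cauchy hq n k hf hn hx) hx.1
  have h2 := abs_solApprox_sub_le hq n (c := c) hn hx
  calc |sol hq c f x - f x| ≤ |sol hq c f x - solApprox hq n c f x| +
        |solApprox hq n c f x - f x| := abs_sub_le _ _ _
    _ ≤ ε / 2 + ε / 2 := add_le_add h1 h2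
    _ = ε := add_halves ε

/-! ### The solution is harmonic -/

/-- The Gauss–Green formula for the solution. -/
lemma energy_sol (hq : AffineIndependent ℝ q) (m : ℕ) (c : ℝ) {f : Plane → ℝ}
    (hf : ContinuousOn f (X q)) {v : Plane → ℝ} (hv : Vanish q {x ∈ gasket q | 0 < ha q x} m v) :
    energy q m (sol hq c f) v = 3 * (c - integralX q f) * v (q 1) := by
  -- The set in `hv` contains `q 1`, unlike `Ω`: in the induction the images of `q 1` in the cells 0
  -- and 3 are the inner vertices `z_∅` and `x_∅`, where test functions need not vanish.
  have hK : ¬ gasket q ⊆ {x ∈ gasket q | 0 < ha q x} := fun h => by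
    have := (h (corner_mem 0)).2
    simp [ha_corner hq] at this
  induction m generalizing c f v with
  | zero =>
    have h0 : ∀ a, v (q a) = 0 := hv [] rfl (by simpa [Fw] using hK)
    rw [energy_zero, h0 1]
    simp [tri, h0]
  | succ m ih =>
    have haxis : ∀ i, (i = 0 ∨ i = 3) → Vanish q {x ∈ gasket q | 0 < ha q x} m (v ∘ F q i) := by
      intro i hi w hw hs a
      refine hv (i :: w) (by simp [hw]) (fun h => hs ?_) a
      rintro _ ⟨x, hx, rfl⟩
      have h1 := (h (mem_image_of_mem _ hx)).2
      simp only [Fw, Function.comp_apply, ha_F_axis hq hi (Fw_mem w hx)] at h1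
      exact ⟨Fw_mem w hx, (mul_pos_iff_of_pos_left (haRatio_pos i)).1 h1⟩
    -- This applies to the cells 2 and 4, so the reflected half of `sol` contributes nothing.
    have hneg : ∀ i, (∀ x ∈ gasket q, ha q (F q i x) ≤ 0) → ∀ x ∈ V q m, v (F q i x) = 0 := by
      intro i hi x hx
      obtain ⟨w, hw, a, rfl⟩ := exists_Fw_corner hx
      refine hv (i :: w) (by simp [hw]) (fun h => ?_) a
      have h1 := (h (mem_image_of_mem _ (corner_mem 0))).2
      exact absurd (hi _ (Fw_mem w (corner_mem 0))) (not_le.2 h1)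
    have hzero : ∀ i, (∀ x ∈ gasket q, ha q (F q i x) ≤ 0) → ∀ u,
        energy q m u (v ∘ F q i) = 0 := by
      intro i hi u
      refine (energy_congr (v' := fun _ => 0) (fun _ _ => rfl) fun x hx => hneg i hi x hx).trans ?_
      simp [energy]
    have hsol : ∀ i, energy q m (sol hq c f ∘ F q i) (v ∘ F q i) =
        energy q m (pieces hq (sol hq) c f i) (v ∘ F q i) := fun i =>
      energy_congr (fun x hx => sol_F hq c hf i (V_subset m hx)) fun _ _ => rfl
    have e0 : energy q m (pieces hq (sol hq) c f 0) (v ∘ F q 0) =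
        3 * (zval q c f - integralX q (f ∘ F q 0)) * v (F q 0 (q 1)) :=
      ih _ (continuousOn_comp_F hq hf (.inl rfl)) (haxis 0 (.inl rfl))
    have e3 : energy q m (pieces hq (sol hq) c f 3) (v ∘ F q 3) =
        3 * (xval q c f - integralX q (f ∘ F q 3)) * v (F q 3 (q 1)) :=
      ih _ (continuousOn_comp_F hq hf (.inr rfl)) (haxis 3 (.inr rfl))
    have e1 : energy q m (pieces hq (sol hq) c f 1) (v ∘ F q 1) =
        tri (v ∘ F q 1 ∘ q) ![yval q c f, c, xval q c f] :=
      (energy_comm _ _ _).trans (energy_harm hq m (v ∘ F q 1) _)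
    have e5 : energy q m (pieces hq (sol hq) c f 5) (v ∘ F q 5) =
        tri (v ∘ F q 5 ∘ q) ![zval q c f, yval q c f, f (pv q)] :=
      (energy_comm _ _ _).trans (energy_harm hq m (v ∘ F q 5) _)
    have hp : v (vertex q 3) = 0 := by
      have := hneg 4 (fun x hx => ha_F_four_nonpos hq hx) (q 1) (corner_mem_V m 1)
      rwa [F_eq_vertex] at this
    have h1 : v (q 1) = v (vertex q 1) := congrArg v (F_corner_self q).2.1.symm
    -- What remains is linear in `v` at `x_∅`, `y_∅`, `z_∅` and `q 1`: the first three coefficients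
    -- vanish by the choice of the formulas, the last is the flux at `q 1`.
    rw [energy_succ, Fin.sum_univ_six, hzero 2 fun x hx => (ha_F_two_neg hq hx).le,
      hzero 4 fun x hx => ha_F_four_nonpos hq hx, hsol, hsol, hsol, hsol, e0, e1, e3, e5,
      integralX_split hq hf, h1]
    simp only [tri, Fin.sum_univ_three, Function.comp_apply, F_eq_vertex, vertexIndex]
    simp [xval, yval, zval, hp]
    ring

lemma sol_isWeak (hq : AffineIndependent ℝ q) (c : ℝ) {f : Plane → ℝ} (hf : ContinuousOn f (X q)) :
    IsWeak q (Ω q) (sol hq c f) := by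
  intro m v hv
  have h1 : v (q 1) = 0 := by
    obtain ⟨w, hw, b, hb⟩ := exists_Fw_corner (corner_mem_V (q := q) m 1)
    rw [← hb]
    refine hv w hw (fun hs => corner_notMem_Ω (q := q) 1 ?_) b
    rw [← hb]
    exact hs (mem_image_of_mem _ (corner_mem b))
  rw [energy_sol hq m c hf, h1, mul_zero]
  exact fun w hw hs => hv w hw fun h => hs (h.trans fun x hx => ⟨hx.1.1, hx.2⟩)

lemma harm_Fw (hq : AffineIndependent ℝ q) (w : List (Fin 6)) (a : Fin 3 → ℝ) :
    ∃ b, EqOn (harm hq a ∘ Fw q w) (harm hq b) (gasket q) := by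
  induction w generalizing a with
  | nil => exact ⟨a, fun _ _ => rfl⟩
  | cons i w ih =>
    obtain ⟨b, hb⟩ := ih (sub a i)
    exact ⟨b, fun x hx => (harm_F hq a i (Fw_mem w hx)).trans (hb hx)⟩

/-- A cell where `ha > 0` throughout cannot have a word in 0 and 3 alone, since such a cell contains
an image of `q 0`. Its word thus reaches a harmonic piece. -/
lemma sol_Fw (hq : AffineIndependent ℝ q) (w : List (Fin 6)) (c : ℝ) {f : Plane → ℝ}
    (hf : ContinuousOn f (X q)) (hw : ∀ x ∈ gasket q, 0 < ha q (Fw q w x)) :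
    ∃ b, EqOn (sol hq c f ∘ Fw q w) (harm hq b) (gasket q) := by
  induction w generalizing c f with
  | nil =>
    have := hw _ (corner_mem 0)
    simp [Fw, ha_corner hq] at this
  | cons i w ih =>
    have hF : EqOn (sol hq c f ∘ Fw q (i :: w)) (pieces hq (sol hq) c f i ∘ Fw q w) (gasket q) :=
      fun x hx => sol_F hq c hf i (Fw_mem w hx)
    have haxis : (i = 0 ∨ i = 3) → ∀ x ∈ gasket q, 0 < ha q (Fw q w x) := fun hi x hx => by
      have h1 := hw x hx
      simp only [Fw, Function.comp_apply, ha_F_axis hq hi (Fw_mem w hx)] at h1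
      exact (mul_pos_iff_of_pos_left (haRatio_pos i)).1 h1
    have hharm : ∀ a, pieces hq (sol hq) c f i = harm hq a →
        ∃ b, EqOn (sol hq c f ∘ Fw q (i :: w)) (harm hq b) (gasket q) := fun a ha => by
      obtain ⟨b, hb⟩ := harm_Fw hq w a
      rw [ha] at hF
      exact ⟨b, hF.trans hb⟩
    fin_cases i
    · obtain ⟨b, hb⟩ := ih (zval q c f) (continuousOn_comp_F hq hf (.inl rfl)) (haxis (.inl rfl))
      exact ⟨b, hF.trans hb⟩
    · exact hharm _ rfl
    · exact hharm _ rfl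
    · obtain ⟨b, hb⟩ := ih (xval q c f) (continuousOn_comp_F hq hf (.inr rfl)) (haxis (.inr rfl))
      exact ⟨b, hF.trans hb⟩
    · exact hharm _ rfl
    · exact hharm _ rfl

lemma isCompact_gasket_diff_Ω (hq : AffineIndependent ℝ q) : IsCompact (gasket q \ Ω q) := by
  have e : gasket q \ Ω q = {x ∈ gasket q | ha q x ≤ 0} ∪ {q 1} := by
    ext x
    simp only [Set.mem_sdiff, mem_Ω_iff hq, mem_union, mem_ofPred_eq, mem_singleton_iff]
    constructor
    · rintro ⟨h1, h2⟩
      by_contra! h3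
      exact h2 ⟨h1, h3.1 h1, h3.2⟩
    · rintro (⟨h1, h2⟩ | rfl)
      · exact ⟨h1, fun h => not_lt.2 h2 h.2.1⟩
      · exact ⟨corner_mem 1, fun h => h.2.2 rfl⟩
  refine (gasket_compact q).of_isClosed_subset ?_ sdiff_subset
  rw [e]
  exact (isClosed_ha_le hq).union isClosed_singleton

lemma IsWeak.harmonicIn_Ω (hq : AffineIndependent ℝ q) {u : Plane → ℝ} (hu : IsWeak q (Ω q) u)
    (hw : ∀ w : List (Fin 6), Fw q w '' gasket q ⊆ Ω q → MemDom q (u ∘ Fw q w)) :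
    HarmonicIn q (Ω q) u := by
  refine ⟨hw, fun v _ hv => ?_⟩
  obtain ⟨m₀, hm⟩ := vanish_eventually (v := v) (isCompact_gasket_diff_Ω hq) Subset.rfl (by
    rw [← disjoint_iff_inter_eq_empty]
    exact disjoint_sdiff_right.mono_left hv)
  refine tendsto_const_nhds.congr' ?_
  filter_upwards [eventually_ge_atTop m₀] with m hmm
  exact (hu m v (hm m hmm)).symm

lemma sol_isDirichletSolution (hq : AffineIndependent ℝ q) {f : Plane → ℝ}
    (hf : ContinuousOn f (bdry q)) : IsDirichletSolution q f (sol hq (f (q 1)) f) := by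
  have hfX : ContinuousOn f (X q) := hf.mono subset_union_right
  refine ⟨(sol_continuousOn hq _ hfX).mono (closure_Ω_subset hq), ?_, ?_⟩
  · refine (sol_isWeak hq _ hfX).harmonicIn_Ω hq fun w hw => ?_
    obtain ⟨b, hb⟩ := sol_Fw hq w (f (q 1)) hfX fun x hx => (hw (mem_image_of_mem _ hx)).2
    exact memDom_of_eqOn_harm hq hb
  · rintro x (rfl | hx)
    · exact sol_corner hq _ hfX 1
    · exact sol_eqOn_X hq _ hfX hx

/-! ### Uniqueness and self-similarity of solutions -/

lemma IsDirichletSolution.eqOn (hq : AffineIndependent ℝ q) {f u v : Plane → ℝ}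
    (hu : IsDirichletSolution q f u) (hv : IsDirichletSolution q f v) :
    EqOn u v (closure (Ω q)) := by
  -- The difference is extended by zero beyond `X`, where it vanishes, to bring the maximum
  -- principle on the whole gasket to bear.
  set d : Plane → ℝ := fun x => if 0 ≤ ha q x then u x - v x else 0
  have hb : ∀ x ∈ bdry q, u x - v x = 0 := fun x hx =>
    sub_eq_zero.2 ((hu.boundary hx).trans (hv.boundary hx).symm)
  have hpos : EqOn d (fun x => u x - v x) {x ∈ gasket q | 0 ≤ ha q x} := fun x hx => if_pos hx.2
  have hneg : EqOn d (fun _ => 0) {x ∈ gasket q | ha q x ≤ 0} := fun x hx => by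
    by_cases h : 0 ≤ ha q x
    · exact (if_pos h).trans (hb x (.inr ⟨hx.1, le_antisymm hx.2 h⟩))
    · exact if_neg h
  have hc : ContinuousOn d (gasket q) := by
    have h1 : ContinuousOn d {x ∈ gasket q | 0 ≤ ha q x} := by
      refine ContinuousOn.congr ?_ hpos
      rw [← closure_Ω hq]
      exact hu.continuousOn.sub hv.continuousOn
    refine (h1.union_of_isClosed (continuousOn_const.congr hneg) (isClosed_le_ha hq)
      (isClosed_ha_le hq)).mono fun x hx => ?_
    exact (le_total 0 (ha q x)).imp (fun h => ⟨hx, h⟩) fun h => ⟨hx, h⟩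
  have hw : IsWeak q (Ω q) d := ((hu.harmonicIn.isWeak hq).sub (hv.harmonicIn.isWeak hq)).congr
    fun x hx => hpos ⟨hx.1.1, hx.2.le⟩
  intro x hx
  rw [closure_Ω hq] at hx
  refine sub_eq_zero.1 ((hpos hx).symm.trans
    (hw.eq_zero hc ?_ ⟨q 0, corner_mem 0, corner_notMem_Ω 0⟩ hx.1))
  rintro y ⟨hy, hyΩ⟩
  rcases le_or_gt (ha q y) 0 with h | h
  · exact hneg ⟨hy, h⟩
  · have : y = q 1 := by
      by_contra h1
      exact hyΩ ((mem_Ω_iff hq).2 ⟨hy, h, h1⟩)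
    exact (hpos ⟨hy, h.le⟩).trans (hb y (.inl this))

/-- The boundary data are those of `u ∘ F_i` itself, because its value at `q 1` is an interior value
of `u`. -/
lemma IsDirichletSolution.comp_F (hq : AffineIndependent ℝ q) {f u : Plane → ℝ}
    (hu : IsDirichletSolution q f u) {i : Fin 6} (hi : i = 0 ∨ i = 3) :
    IsDirichletSolution q (u ∘ F q i) (u ∘ F q i) := by
  have hΩ : ∀ x ∈ Ω q, F q i x ∈ Ω q := fun x hx => F_axis_mem_Ω hq hi hx.1.1 hx.2
  refine ⟨hu.continuousOn.comp (F_continuous q i).continuousOn fun x hx => F_mem_closure_Ω hq hi hx,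
    ((hu.harmonicIn.isWeak hq).comp_F hq i hΩ corner_notMem_Ω).harmonicIn_Ω hq fun w hw => ?_,
    fun _ _ => rfl⟩
  refine hu.harmonicIn.1 (i :: w) ?_
  rintro _ ⟨x, hx, rfl⟩
  exact hΩ _ (hw (mem_image_of_mem _ hx))

lemma IsDirichletSolution.comp_Fw (hq : AffineIndependent ℝ q) {f u : Plane → ℝ}
    (hu : IsDirichletSolution q f u) {w : List (Fin 6)} (hw : ∀ i ∈ w, i = 0 ∨ i = 3) :
    IsDirichletSolution q (u ∘ Fw q w) (u ∘ Fw q w) := by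
  induction w generalizing f u with
  | nil => exact ⟨hu.continuousOn, hu.harmonicIn, fun _ _ => rfl⟩
  | cons i w ih =>
    exact ih (hu.comp_F hq (hw i List.mem_cons_self)) fun j hj => hw j (List.mem_cons_of_mem _ hj)

/-- The values of a solution at the three crucial vertices. -/
lemma IsDirichletSolution.values (hq : AffineIndependent ℝ q) {f u : Plane → ℝ}
    (hf : ContinuousOn f (bdry q)) (hu : IsDirichletSolution q f u) :
    u (xv q) = xval q (f (q 1)) f ∧ u (yv q) = yval q (f (q 1)) f ∧
      u (zv q) = zval q (f (q 1)) f := by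
  have hfX : ContinuousOn f (X q) := hf.mono subset_union_right
  have h := hu.eqOn hq (sol_isDirichletSolution hq hf)
  have h1 : ∀ k, u (F q 1 (q k)) = ![yval q (f (q 1)) f, f (q 1), xval q (f (q 1)) f] k := fun k =>
    (h (F_one_mem_closure_Ω hq (corner_mem k))).trans
      ((sol_F hq _ hfX 1 (corner_mem k)).trans (harm_corner hq _ k))
  have h5 : ∀ k, u (F q 5 (q k)) = ![zval q (f (q 1)) f, yval q (f (q 1)) f, f (pv q)] k := fun k =>
    (h (F_five_mem_closure_Ω hq (corner_mem k))).trans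
      ((sol_F hq _ hfX 5 (corner_mem k)).trans (harm_corner hq _ k))
  refine ⟨h1 2, h1 0, ?_⟩
  -- The same vertex seen from cell 5, where the solution is known to be harmonic.
  have e : zv q = F q 5 (q 0) := by
    rw [zv, F_eq_vertex, F_eq_vertex]
    rfl
  rw [e]
  exact h5 0

/-- Only the corner `q 1` of this cell is outside `Ω`. Continuity there suffices, by
`IsWeak.eqOn_harm`; in cell 5 the exceptional corner is `p_∅`. -/
lemma IsDirichletSolution.isHarmonic_one (hq : AffineIndependent ℝ q) {f u : Plane → ℝ}
    (hu : IsDirichletSolution q f u) : IsHarmonic q (u ∘ F q 1) := by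
  refine isHarmonic_of_eqOn_harm hq (((hu.harmonicIn.isWeak hq).comp_F hq 1 (fun x hx => ?_)
    fun a h => h.2 (mem_range_self a)).eqOn_harm hq ?_)
  · exact F_one_mem_Ω hq hx.1 fun h => hx.2 (h ▸ mem_range_self 1)
  · exact hu.continuousOn.comp (F_continuous q 1).continuousOn fun x hx =>
      F_one_mem_closure_Ω hq hx

lemma IsDirichletSolution.isHarmonic_five (hq : AffineIndependent ℝ q) {f u : Plane → ℝ}
    (hu : IsDirichletSolution q f u) : IsHarmonic q (u ∘ F q 5) := by
  refine isHarmonic_of_eqOn_harm hq (((hu.harmonicIn.isWeak hq).comp_F hq 5 (fun x hx => ?_)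
    fun a h => h.2 (mem_range_self a)).eqOn_harm hq ?_)
  · exact F_five_mem_Ω hq hx.1 fun h => hx.2 (h ▸ mem_range_self 2)
  · exact hu.continuousOn.comp (F_continuous q 5).continuousOn fun x hx =>
      F_five_mem_closure_Ω hq hx

end SG3

end

/-! ### The theorem. -/

theorem theorem2p2 (q : Fin 3 → SG3.Plane) (hq : AffineIndependent ℝ q)
    (f : SG3.Plane → ℝ) (hf : ContinuousOn f (SG3.bdry q)) :
    -- existence
    (∃ u, SG3.IsDirichletSolution q f u) ∧
    -- uniqueness
    (∀ u v, SG3.IsDirichletSolution q f u → SG3.IsDirichletSolution q f v →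
      EqOn u v (closure (SG3.Ω q))) ∧
    (∀ u, SG3.IsDirichletSolution q f u →
      -- the values at the three crucial vertices
      u (SG3.xv q) = 4 / 15 * f (q 1) + 1 / 15 * f (SG3.pv q)
          + 1 / 30 * (∫ s in SG3.X q, f (SG3.F q 0 s) ∂(SG3.μ q))
          + 19 / 30 * (∫ s in SG3.X q, f (SG3.F q 3 s) ∂(SG3.μ q)) ∧
      u (SG3.yv q) = 1 / 3 * f (q 1) + 1 / 3 * f (SG3.pv q)
          + 1 / 6 * (∫ s in SG3.X q, f (SG3.F q 0 s) ∂(SG3.μ q))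
          + 1 / 6 * (∫ s in SG3.X q, f (SG3.F q 3 s) ∂(SG3.μ q)) ∧
      u (SG3.zv q) = 1 / 15 * f (q 1) + 4 / 15 * f (SG3.pv q)
          + 19 / 30 * (∫ s in SG3.X q, f (SG3.F q 0 s) ∂(SG3.μ q))
          + 1 / 30 * (∫ s in SG3.X q, f (SG3.F q 3 s) ∂(SG3.μ q)) ∧
      -- self-similarity: for every word `w` in `0` and `3`
      (∀ w : SG3.HalfWord,
        -- `u ∘ F_w` solves the Dirichlet problem again, with boundary data `f ∘ F_w` on `X`
        SG3.IsDirichletSolution q (u ∘ SG3.Fw q w.1) (u ∘ SG3.Fw q w.1) ∧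
        EqOn (u ∘ SG3.Fw q w.1) (f ∘ SG3.Fw q w.1) (SG3.X q) ∧
        -- so the values at `x_w`, `y_w`, `z_w` follow from `u (F_w q_1)` and `f`
        u (SG3.Fw q w.1 (SG3.xv q)) =
          4 / 15 * u (SG3.Fw q w.1 (q 1)) + 1 / 15 * f (SG3.Fw q w.1 (SG3.pv q))
            + 1 / 30 * (∫ s in SG3.X q, f (SG3.Fw q w.1 (SG3.F q 0 s)) ∂(SG3.μ q))
            + 19 / 30 * (∫ s in SG3.X q, f (SG3.Fw q w.1 (SG3.F q 3 s)) ∂(SG3.μ q)) ∧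
        u (SG3.Fw q w.1 (SG3.yv q)) =
          1 / 3 * u (SG3.Fw q w.1 (q 1)) + 1 / 3 * f (SG3.Fw q w.1 (SG3.pv q))
            + 1 / 6 * (∫ s in SG3.X q, f (SG3.Fw q w.1 (SG3.F q 0 s)) ∂(SG3.μ q))
            + 1 / 6 * (∫ s in SG3.X q, f (SG3.Fw q w.1 (SG3.F q 3 s)) ∂(SG3.μ q)) ∧
        u (SG3.Fw q w.1 (SG3.zv q)) =
          1 / 15 * u (SG3.Fw q w.1 (q 1)) + 4 / 15 * f (SG3.Fw q w.1 (SG3.pv q))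
            + 19 / 30 * (∫ s in SG3.X q, f (SG3.Fw q w.1 (SG3.F q 0 s)) ∂(SG3.μ q))
            + 1 / 30 * (∫ s in SG3.X q, f (SG3.Fw q w.1 (SG3.F q 3 s)) ∂(SG3.μ q)) ∧
        -- and `u` is harmonic on the cells `F_w F_1 K` and `F_w F_5 K`
        SG3.IsHarmonic q (u ∘ SG3.Fw q w.1 ∘ SG3.F q 1) ∧
        SG3.IsHarmonic q (u ∘ SG3.Fw q w.1 ∘ SG3.F q 5))) ∧
    -- a harmonic function on the gasket is determined by its values at the three corners
    (∀ g h, SG3.IsHarmonic q g → SG3.IsHarmonic q h → EqOn g h (SG3.V q 0) →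
      EqOn g h (SG3.gasket q)) ∧
    -- the cells `F_w F_1 K` and `F_w F_5 K` exhaust a dense subset of the closure of `Ω`
    closure (SG3.Ω q) = closure (⋃ w : SG3.HalfWord,
      SG3.Fw q w.1 '' (SG3.F q 1 '' SG3.gasket q ∪ SG3.F q 5 '' SG3.gasket q)) := by
  refine ⟨⟨_, SG3.sol_isDirichletSolution hq hf⟩, fun u v hu hv => hu.eqOn hq hv, fun u hu => ?_,
    fun g h hg hh h0 => hg.eqOn hq hh h0, SG3.closure_Ω_eq_closure_iUnion hq⟩
  obtain ⟨hx, hy, hz⟩ := hu.values hq hf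
  refine ⟨hx, hy, hz, fun w => ?_⟩
  have hw := hu.comp_Fw hq w.2
  have hX : EqOn (u ∘ SG3.Fw q w.1) (f ∘ SG3.Fw q w.1) (SG3.X q) := fun x hx =>
    hu.boundary (.inr (SG3.Fw_mem_X hq w.2 hx))
  have hp : u (SG3.Fw q w.1 (SG3.pv q)) = f (SG3.Fw q w.1 (SG3.pv q)) := hX (SG3.pv_mem_X hq)
  -- The integrals see only `X`, so `f` may replace `u` in them; only the value at `F_w q_1` stays
  -- that of `u`.
  have hI : ∀ i, (i = 0 ∨ i = 3) → SG3.integralX q ((u ∘ SG3.Fw q w.1) ∘ SG3.F q i) =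
      ∫ s in SG3.X q, f (SG3.Fw q w.1 (SG3.F q i s)) ∂(SG3.μ q) := fun i hi =>
    SG3.integralX_congr hq fun x hx => hX (SG3.F_mem_X hq hi hx)
  obtain ⟨hwx, hwy, hwz⟩ := hw.values hq (hw.continuousOn.mono (SG3.bdry_subset hq))
  rw [SG3.xval, hI 0 (.inl rfl), hI 3 (.inr rfl)] at hwx
  rw [SG3.yval, hI 0 (.inl rfl), hI 3 (.inr rfl)] at hwy
  rw [SG3.zval, hI 0 (.inl rfl), hI 3 (.inr rfl)] at hwz
  simp only [Function.comp_apply, hp] at hwx hwy hwz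
  exact ⟨hw, hX, hwx, hwy, hwz, hw.isHarmonic_one hq, hw.isHarmonic_five hq⟩
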